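/- **Setting.** A processor has speeds $0=s_0<s_1<\dots<s_k$ with power consumptions $P_0=0$ and $P_1,\dots,P_k>0$; the speeds are well-separated, i.e. with $\Delta_i=\frac{P_i-P_{i-1}}{s_i-s_{i-1}}$ there is a constant $c>1$ with $\Delta_{i+1}=c\,\Delta_i$ for all $i$. Each of $n$ jobs $j$ has a release time $r_j\ge 0$, a deadline $d_j>r_j$ and a workload $p_j\ge 0$, and is *active* on $[r_j,d_j)$. A schedule $S$ chooses at every time a job and a speed $s_i$ with $i\ge1$, or idles at speed $s_0$. It is *feasible* at recharge rate $R\ge0$ if jobs are processed only while active, every job $j$ receives at least $p_j$ units of work, and for every $t\ge0$ the battery level $R\,t-E_S([0,t))$ is non-negative, where $E_S(A)$ denotes the energy used during $A$. The pair $(S,R)$ is *optimal* if $S$ is feasible at rate $R$ and no schedule is feasible at a smaller rate. *Depletion points* are finitely many labelled times $0<\tau_1<\dots<\tau_L$ at which the battery level is $0$; with $\tau_0=0$ and $\tau_{L+1}=\infty$ the *depletion intervals* are $I_\ell=[\tau_{\ell-1},\tau_\ell)$, $1\le\ell\le L+1$. A depletion point $\tau$ is a *split depletion point* if no job with deadline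 greater than $\tau$ is processed before $\tau$ (all "processed" statements are up to null sets of times). *Weak EDF* for a relation "$j$ is run in $I_\ell$" means that some schedule that processes jobs only while active and follows earliest deadline first runs every job in exactly the prescribed intervals. The schedule $S$ with rate $R$ and these depletion points is *perfect* if 1. it is feasible, and each job $j$ receives exactly $p_j$ units of work; 2. in each $I_\ell$ it uses the least energy among all schedules that process jobs only while active and process the same amount of every job in $I_\ell$; 3. it satisfies weak EDF; 4. it satisfies the speed level relation: there are $\mathcal L(j,\ell)\in\mathbb N$ such that, with $s_{j,\ell}$ the average speed of $j$ over the time at which it is processed in $I_\ell$: (a) if $j$ is processed in $I_\ell$ and $s_{j,\ell}\in(s_{i-1},s_i)$, then $\mathcal L(j,\ell)=i$; (b) if $j$ is processed in $I_\ell$ and $s_{j,\ell}=s_i$, then $\mathcal L(j,\ell)\in\{i,i+1\}$; (c) if $j,j'$ are both active in $I_{\ell_1}$ and in $I_{\ell_2}$ with $\ell_1<\ell_2$, then $\mathcal L(j,\ell_2)-\mathcal L(j,\ell_1)=\mathcal L(j',\ell_2)-\mathcal L(j',\ell_1)\ge0$; (d) for almost every $t\in I_\ell$ and every $j'$ active at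 $t$: if job $j$ is processed at $t$, then $\mathcal L(j',\ell)\le\mathcal L(j,\ell)$, and if the processor idles at $t$, then $\mathcal L(j',\ell)\le1$. An *$\varepsilon$-transfer* (active or inactive) from $I_{\ell_0}$ to $I_{\ell_s}$, $s\ge1$, is a sequence of intervals $\ell_0,\dots,\ell_s$ (consecutive ones distinct) and jobs $j_1,\dots,j_s$ such that one can, simultaneously for all $a$, move a positive amount of the work of $j_a$ processed in $I_{\ell_{a-1}}$ to $I_{\ell_a}$ so that in the new distribution of work over the intervals every job still receives its workload, has work only in intervals in which it is active, weak EDF holds, and the average speeds at which YDS runs the jobs in $I_{\ell_1},\dots,I_{\ell_{s-1}}$ are unchanged (a job that had, or is left with, no work in such an interval has no speed to compare). Neither the battery nor the top speed $s_k$ restricts an $\varepsilon$-transfer. A path of $\varepsilon$-transfers may be empty. **Lemma.** Let $S$, $R$, $\tau_1<\dots<\tau_L$ be perfect. Suppose no further merging of depletion intervals is possible at a stuck interval: for every $\ell\in\{2,\dots,L+1\}$ such that $I_\ell$ has no path of $\varepsilon$-transfers to $I_{L+1}$, some job processed in $I_\ell$ has a release time smaller than $\tau_{\ell-1}$. If some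 depletion interval $I_{\ell_0}$ has no path of $\varepsilon$-transfers to the rightmost interval $I_{L+1}$, then one of $\tau_1,\dots,\tau_L$ is a split depletion point, and $(S,R)$ is optimal. -/

import Mathlib

noncomputable section

namespace Solar

/-- A problem instance: `n` jobs with release times, deadlines and workloads, and a processor with
speeds `0 = s₀ < s₁ < ⋯ < s_k` and power consumptions `P₀ = 0`, `P₁, …, P_k > 0`. -/
structure Instance (n k : ℕ) where
  release : Fin n → ℝ
  deadline : Fin n → ℝ
  workload : Fin n → ℝ
  speed : Fin (k + 1) → ℝ
  power : Fin (k + 1) → ℝ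
  release_nonneg : ∀ j, 0 ≤ release j
  release_lt_deadline : ∀ j, release j < deadline j
  workload_nonneg : ∀ j, 0 ≤ workload j
  speed_zero : speed 0 = 0
  speed_strictMono : StrictMono speed
  power_zero : power 0 = 0
  power_pos : ∀ i, i ≠ 0 → 0 < power i

/-- A schedule: at each time a speed index and a job; the processor idles (no job) exactly when
the speed index is `0`. -/
structure Schedule (n k : ℕ) where
  level : ℝ → Fin (k + 1)
  job : ℝ → Option (Fin n)
  measurable_level : Measurable level
  measurableSet_job : ∀ j, MeasurableSet {t | job t = some j}
  idle_iff : ∀ t, job t = none ↔ level t = 0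

/-- The `ℓ`-th interval (`ℓ = 0, …, L`) cut out of `[0, ∞)` by the points `τ₀ < ⋯ < τ_{L-1}`, that
is `[τ_{ℓ-1}, τ_ℓ)` with the conventions `τ_{-1} = 0` and `τ_L = ∞`. -/
def interval {L : ℕ} (τ : Fin L → ℝ) (ℓ : Fin (L + 1)) : Set ℝ :=
  {t | 0 ≤ t ∧ (∀ i : Fin L, i.val < ℓ.val → τ i ≤ t) ∧ (∀ i : Fin L, ℓ.val ≤ i.val → t < τ i)}

namespace Instance

variable {n k L : ℕ} (M : Instance n k)

/-- The half-open interval `[r_j, d_j)` in which job `j` may be processed. -/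
def window (j : Fin n) : Set ℝ := Set.Ico (M.release j) (M.deadline j)

/-- `Δ_{i+1} = (P_{i+1} - P_i) / (s_{i+1} - s_i)`, the slope between consecutive speeds. -/
def slope (i : Fin k) : ℝ :=
  (M.power i.succ - M.power i.castSucc) / (M.speed i.succ - M.speed i.castSucc)

/-- The slopes grow by a constant factor `c > 1`. -/
def WellSeparated : Prop :=
  ∃ c : ℝ, 1 < c ∧ ∀ i i' : Fin k, i'.val = i.val + 1 → M.slope i' = c * M.slope i

/-- The work of job `j` processed by `S` during the times in `A`. -/
def work (S : Schedule n k) (j : Fin n) (A : Set ℝ) : ℝ :=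
  ∫ t in A ∩ {t | S.job t = some j}, M.speed (S.level t)

/-- The energy consumed by `S` during the times in `A`. -/
def energy (S : Schedule n k) (A : Set ℝ) : ℝ :=
  ∫ t in A, M.power (S.level t)

/-- The energy level of the (initially empty) battery at time `t`, for recharge rate `R`. -/
def battery (S : Schedule n k) (R t : ℝ) : ℝ :=
  R * t - M.energy S (Set.Ico 0 t)

def RespectsWindows (S : Schedule n k) : Prop :=
  ∀ t j, S.job t = some j → t ∈ M.window j

/-- `S` is a feasible schedule at recharge rate `R`. -/
def Feasible (S : Schedule n k) (R : ℝ) : Prop :=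
  0 ≤ R ∧ M.RespectsWindows S ∧ (∀ j, M.workload j ≤ M.work S j Set.univ) ∧
    ∀ t, 0 ≤ t → 0 ≤ M.battery S R t

/-- `S` is feasible at rate `R`, and no schedule is feasible at a smaller rate. -/
def Optimal (S : Schedule n k) (R : ℝ) : Prop :=
  M.Feasible S R ∧ ∀ (S' : Schedule n k) (R' : ℝ), M.Feasible S' R' → R ≤ R'

/-- The points of `τ` are positive, increasing, and the battery is empty at each of them. -/
def DepletionPoints (S : Schedule n k) (R : ℝ) (τ : Fin L → ℝ) : Prop :=
  StrictMono τ ∧ ∀ i, 0 < τ i ∧ M.battery S R (τ i) = 0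

/-- Job `j` is active at some time of the `ℓ`-th depletion interval. -/
def ActiveIn (τ : Fin L → ℝ) (j : Fin n) (ℓ : Fin (L + 1)) : Prop :=
  (interval τ ℓ ∩ M.window j).Nonempty

/-- Job `j` is processed in the `ℓ`-th depletion interval. -/
def ProcessedIn (S : Schedule n k) (τ : Fin L → ℝ) (j : Fin n) (ℓ : Fin (L + 1)) : Prop :=
  0 < M.work S j (interval τ ℓ)

/-- The average speed of `j` over the time during which it is processed in the interval `ℓ`. -/
def avgSpeed (S : Schedule n k) (τ : Fin L → ℝ) (j : Fin n) (ℓ : Fin (L + 1)) : ℝ :=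
  M.work S j (interval τ ℓ) / MeasureTheory.volume.real (interval τ ℓ ∩ {t | S.job t = some j})

/-- In every depletion interval, `S` uses the least energy among all schedules that process the
same amount of each job in that interval. -/
def LocallyEnergyOptimal (S : Schedule n k) (τ : Fin L → ℝ) : Prop :=
  ∀ (ℓ : Fin (L + 1)) (S' : Schedule n k), M.RespectsWindows S' →
    (∀ j, M.work S' j (interval τ ℓ) = M.work S j (interval τ ℓ)) →
    M.energy S (interval τ ℓ) ≤ M.energy S' (interval τ ℓ)

/-- The Speed Level Relation. The last clause treats idle time like the lowest speed `s₀ = 0`,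
whose possible speed levels are `0` and `1`. -/
def SpeedLevelRelation (S : Schedule n k) (τ : Fin L → ℝ) : Prop :=
  ∃ lev : Fin n → Fin (L + 1) → ℕ,
    (∀ j ℓ, M.ProcessedIn S τ j ℓ → ∀ i : Fin k,
      M.speed i.castSucc < M.avgSpeed S τ j ℓ → M.avgSpeed S τ j ℓ < M.speed i.succ →
      lev j ℓ = i.val + 1) ∧
    (∀ j ℓ, M.ProcessedIn S τ j ℓ → ∀ i : Fin (k + 1), M.avgSpeed S τ j ℓ = M.speed i →
      lev j ℓ = i.val ∨ lev j ℓ = i.val + 1) ∧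
    (∀ j j' ℓ₁ ℓ₂, ℓ₁ < ℓ₂ → M.ActiveIn τ j ℓ₁ → M.ActiveIn τ j ℓ₂ →
      M.ActiveIn τ j' ℓ₁ → M.ActiveIn τ j' ℓ₂ →
      lev j ℓ₁ ≤ lev j ℓ₂ ∧
        (lev j ℓ₂ : ℤ) - (lev j ℓ₁ : ℤ) = (lev j' ℓ₂ : ℤ) - (lev j' ℓ₁ : ℤ)) ∧
    (∀ j j' ℓ, ∀ᵐ t, t ∈ interval τ ℓ → S.job t = some j → t ∈ M.window j' →
      lev j' ℓ ≤ lev j ℓ) ∧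
    (∀ j ℓ, ∀ᵐ t, t ∈ interval τ ℓ → S.job t = none → t ∈ M.window j → lev j ℓ ≤ 1)

/-- Earliest deadline first: while `q` is processed, every released job that is not finished
(it is processed at some later time) has a deadline at least that of `q`. -/
def IsEDF (T : Schedule n k) : Prop :=
  ∀ t t' q j, T.job t = some q → t < t' → T.job t' = some j → M.release j ≤ t →
    M.deadline q ≤ M.deadline j

/-- Weak EDF, for the relation `A j ℓ` of job `j` being run in the depletion interval `ℓ`: some
EDF schedule runs each job in exactly these depletion intervals. -/
def WeakEDF (τ : Fin L → ℝ) (A : Fin n → Fin (L + 1) → Prop) : Prop :=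
  ∃ T : Schedule n k, M.RespectsWindows T ∧ M.IsEDF T ∧ ∀ j ℓ, M.ProcessedIn T τ j ℓ ↔ A j ℓ

/-- A perfect schedule with depletion points `τ`. -/
structure Perfect (S : Schedule n k) (R : ℝ) (τ : Fin L → ℝ) : Prop where
  feasible : M.Feasible S R
  exact_work : ∀ j, M.work S j Set.univ = M.workload j
  depletion : M.DepletionPoints S R τ
  energyOptimal : M.LocallyEnergyOptimal S τ
  weakEDF : M.WeakEDF τ (M.ProcessedIn S τ)
  slr : M.SpeedLevelRelation S τ

/-- A distribution `w j ℓ` of the work of the jobs over the depletion intervals is nice if all jobs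
are finished, processed in their windows only, and weak EDF holds. Any such distribution has a YDS
schedule of average speeds in each depletion interval. -/
def NiceDistribution (τ : Fin L → ℝ) (w : Fin n → Fin (L + 1) → ℝ) : Prop :=
  (∀ j ℓ, 0 ≤ w j ℓ) ∧ (∀ j ℓ, 0 < w j ℓ → M.ActiveIn τ j ℓ) ∧
    (∀ j, M.workload j ≤ ∑ ℓ, w j ℓ) ∧ M.WeakEDF τ (fun j ℓ => 0 < w j ℓ)

/-- For the workloads `w` in the depletion interval `ℓ`, YDS runs each job `j` with `0 < w j` at the
constant average speed `v j`: at every time at which such a job is active, the processor is busy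
with a job at least as fast. -/
def IsYDSSpeed (τ : Fin L → ℝ) (ℓ : Fin (L + 1)) (w v : Fin n → ℝ) : Prop :=
  ∃ J : ℝ → Option (Fin n),
    (∀ j, MeasurableSet {t | J t = some j}) ∧
    (∀ t ∈ interval τ ℓ, ∀ j, J t = some j → 0 < w j ∧ t ∈ M.window j) ∧
    (∀ j, 0 < w j → 0 < v j ∧ v j * MeasureTheory.volume.real (interval τ ℓ ∩ {t | J t = some j}) = w j) ∧
    (∀ t ∈ interval τ ℓ, ∀ j, 0 < w j → t ∈ M.window j → ∃ q, J t = some q ∧ v j ≤ v q)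

/-- The work that leaves the interval `ℓ` from job `j` when, for each `a`, the amount `x a` of job
`jb a` is moved from the interval `node a` to the interval `node (a + 1)`. -/
def outflow {s : ℕ} (node : Fin (s + 1) → Fin (L + 1)) (jb : Fin s → Fin n) (x : Fin s → ℝ)
    (j : Fin n) (ℓ : Fin (L + 1)) : ℝ :=
  ∑ a, if jb a = j ∧ node a.castSucc = ℓ then x a else 0

/-- The work that enters the interval `ℓ` for job `j` in the same movement. -/
def inflow {s : ℕ} (node : Fin (s + 1) → Fin (L + 1)) (jb : Fin s → Fin n) (x : Fin s → ℝ)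
    (j : Fin n) (ℓ : Fin (L + 1)) : ℝ :=
  ∑ a, if jb a = j ∧ node a.succ = ℓ then x a else 0

/-- An (active or inactive) ε-transfer of the schedule `S`: positive amounts of the jobs `jb a` can
simultaneously be moved from `node a` to `node (a + 1)` such that the resulting distribution of work
is nice and the YDS speeds of the jobs in the intermediate depletion intervals do not change. -/
def IsTransfer (S : Schedule n k) (τ : Fin L → ℝ) {s : ℕ} (node : Fin (s + 1) → Fin (L + 1))
    (jb : Fin s → Fin n) : Prop :=
  0 < s ∧ (∀ a : Fin s, node a.castSucc ≠ node a.succ) ∧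
  ∃ x : Fin s → ℝ, (∀ a, 0 < x a) ∧
    (∀ j ℓ, outflow node jb x j ℓ ≤ M.work S j (interval τ ℓ)) ∧
    M.NiceDistribution τ (fun j ℓ =>
      M.work S j (interval τ ℓ) - outflow node jb x j ℓ + inflow node jb x j ℓ) ∧
    ∀ b : Fin (s + 1), b ≠ 0 → b ≠ Fin.last s → ∃ v : Fin n → ℝ,
      M.IsYDSSpeed τ (node b) (fun j => M.work S j (interval τ (node b))) v ∧
      M.IsYDSSpeed τ (node b) (fun j => M.work S j (interval τ (node b))
        - outflow node jb x j (node b) + inflow node jb x j (node b)) v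

/-- There is an ε-transfer with source interval `ℓ` and destination interval `ℓ'`. -/
def TransferEdge (S : Schedule n k) (τ : Fin L → ℝ) (ℓ ℓ' : Fin (L + 1)) : Prop :=
  ∃ (s : ℕ) (node : Fin (s + 1) → Fin (L + 1)) (jb : Fin s → Fin n),
    M.IsTransfer S τ node jb ∧ node 0 = ℓ ∧ node (Fin.last s) = ℓ'

/-- There is a (possibly empty) path of ε-transfers from `ℓ` to the rightmost interval. -/
def ReachesRightmost (S : Schedule n k) (τ : Fin L → ℝ) (ℓ : Fin (L + 1)) : Prop :=
  Relation.ReflTransGen (M.TransferEdge S τ) ℓ (Fin.last L)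

/-- The depletion intervals on both sides of `τ i` can be merged: no job processed in the right one
is released before `τ i`. -/
def Mergeable (S : Schedule n k) (τ : Fin L → ℝ) (i : Fin L) : Prop :=
  ∀ j, M.ProcessedIn S τ j i.succ → τ i ≤ M.release j

/-- `τ i` is a split depletion point: no job with a deadline after `τ i` is processed before. -/
def IsSplitPoint (S : Schedule n k) (τ : Fin L → ℝ) (i : Fin L) : Prop :=
  ∀ j, τ i < M.deadline j → M.work S j (Set.Iio (τ i)) = 0

end Instance

end Solar

end

/-!
Call a depletion interval stuck if it has no path of transfers to the rightmost one.

*The split point.* Only transfers of a single job in a single step are needed. They have no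
intermediate intervals, so the condition on the YDS speeds is empty, and by moving half of the work
of the job, one only has to keep weak EDF when the job is added to the target interval
(`transferEdge_of_weakEDF`). Weak EDF fixes the intervals but not the amounts in which an EDF
schedule runs the jobs, so a short piece of that schedule can be overwritten
(`weakEDF_insert`). If the interval on the right of `τ i` is stuck, it is not mergeable, and the
job with the earliest deadline among those processed there and released before `τ i` can be moved
to the left of `τ i`; hence the interval on the left is stuck as well
(`transferEdge_of_not_mergeable`), and the stuck intervals are those up to the last one. If a job
processed in them had a deadline after the end of the last one, then the one with the latest
deadline could be moved to an interval that is not stuck (`deadline_le_of_stuck`). So the end of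
the last stuck interval is a split depletion point.

*Optimality.* Consider the linear program that minimizes the recharge rate, restricted to the times
before the split point `τ i`. By the speed level relation, the differences of speed levels between
intervals come from a nondecreasing potential `x` of the intervals (`exists_potential`). Weighting
the energy used in the interval `ℓ` by `c ^ (-x ℓ)` makes the marginal price of the work of each job
independent of the interval, and since the weights do not increase, they are sums of nonnegative
multipliers of the battery constraints at the depletion points. Local energy optimality makes `S`
run at speeds that are optimal for the price given by the speed level (`ae_supports_level`), so `S`
minimizes the Lagrangian at almost every time (`ae_lagrangian_le`). Every feasible schedule does at
least as much of each job before the split point as `S`, hence uses at least as much weighted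
energy, and the battery of `S` is empty at all the depletion points: a smaller rate is impossible
(`optimal_of_isSplitPoint`).
-/

namespace Solar

open MeasureTheory Set

/-! ### Depletion intervals -/

section Interval

variable {L : ℕ} {τ : Fin L → ℝ}

theorem measurableSet_interval (τ : Fin L → ℝ) (ℓ : Fin (L + 1)) :
    MeasurableSet (interval τ ℓ) := by
  unfold interval
  measurability

theorem lt_of_mem_interval {ℓ ℓ' : Fin (L + 1)} {t t' : ℝ} (ht : t ∈ interval τ ℓ)
    (ht' : t' ∈ interval τ ℓ') (h : ℓ < ℓ') : t < t' := by
  have h1 : ℓ.val < L := by have := ℓ'.isLt; have : ℓ.val < ℓ'.val := h; omega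
  exact (ht.2.2 ⟨ℓ, h1⟩ le_rfl).trans_le (ht'.2.1 ⟨ℓ, h1⟩ h)

theorem eq_of_mem_interval {ℓ ℓ' : Fin (L + 1)} {t : ℝ} (ht : t ∈ interval τ ℓ)
    (ht' : t ∈ interval τ ℓ') : ℓ = ℓ' := by
  rcases lt_trichotomy ℓ ℓ' with h | h | h
  · exact absurd (lt_of_mem_interval ht ht' h) (lt_irrefl _)
  · exact h
  · exact absurd (lt_of_mem_interval ht' ht h) (lt_irrefl _)

theorem exists_mem_interval (hτ : StrictMono τ) {t : ℝ} (ht : 0 ≤ t) :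
    ∃ ℓ, t ∈ interval τ ℓ := by
  classical
  by_cases h : ∃ i, τ i ≤ t
  · obtain ⟨i, hi, hmax⟩ := Finset.exists_max_image (Finset.univ.filter fun i => τ i ≤ t) id
      (by obtain ⟨i, hi⟩ := h; exact ⟨i, by simpa using hi⟩)
    simp only [Finset.mem_filter, Finset.mem_univ, true_and, id] at hi hmax
    refine ⟨i.succ, ht, fun i' h' => (hτ.monotone ?_).trans hi, fun i' h' => ?_⟩
    · simp only [Fin.val_succ] at h'
      exact Fin.le_def.2 (by omega)
    · by_contra! hc
      have := Fin.le_def.1 (hmax i' hc)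
      simp only [Fin.val_succ] at h'
      omega
  · push Not at h
    exact ⟨0, ht, fun i hi => absurd hi (by simp), fun i _ => h i⟩

/-- The points before `τ i` lie in the intervals up to the one that ends at `τ i`. -/
theorem lt_iff_le_castSucc {ℓ : Fin (L + 1)} {t : ℝ} (ht : t ∈ interval τ ℓ) (i : Fin L) :
    t < τ i ↔ ℓ ≤ i.castSucc := by
  constructor
  · intro h
    by_contra! hc
    exact absurd (ht.2.1 i hc) (not_le.2 h)
  · intro h
    exact ht.2.2 i h

end Interval

/-! ### Schedules, work and integrability -/

namespace Schedule

variable {n k : ℕ}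

/-- The schedule that is idle all the time. -/
def idle (n k : ℕ) : Schedule n k where
  level _ := 0
  job _ := none
  measurable_level := measurable_const
  measurableSet_job j := by simp
  idle_iff t := by simp

/-- The schedule that always runs the job `j` at the speed index `i`. -/
def run (j : Fin n) (i : Fin (k + 1)) (hi : i ≠ 0) : Schedule n k where
  level _ := i
  job _ := some j
  measurable_level := measurable_const
  measurableSet_job j' := by by_cases h : j = j' <;> simp [h]
  idle_iff t := by simp [hi]

open Classical in
/-- The schedule that follows `T₁` during the times in `B` and `T₂` at all other times. -/
noncomputable def piecewise (B : Set ℝ) (hB : MeasurableSet B) (T₁ T₂ : Schedule n k) : Schedule n k where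
  level := B.piecewise T₁.level T₂.level
  job := B.piecewise T₁.job T₂.job
  measurable_level := T₁.measurable_level.piecewise hB T₂.measurable_level
  measurableSet_job j := by
    have : {t | B.piecewise T₁.job T₂.job t = some j}
        = B.ite {t | T₁.job t = some j} {t | T₂.job t = some j} := by
      ext t
      by_cases h : t ∈ B <;> simp [Set.ite, h]
    rw [this]
    exact hB.ite (T₁.measurableSet_job j) (T₂.measurableSet_job j)
  idle_iff t := by
    by_cases h : t ∈ B
    · simpa [h] using T₁.idle_iff t
    · simpa [h] using T₂.idle_iff t

variable {B : Set ℝ} (hB : MeasurableSet B) (T₁ T₂ : Schedule n k) {t : ℝ}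

theorem piecewise_job_of_mem (h : t ∈ B) : (piecewise B hB T₁ T₂).job t = T₁.job t := by
  simp [piecewise, h]

theorem piecewise_job_of_notMem (h : t ∉ B) : (piecewise B hB T₁ T₂).job t = T₂.job t := by
  simp [piecewise, h]

theorem piecewise_level_of_mem (h : t ∈ B) : (piecewise B hB T₁ T₂).level t = T₁.level t := by
  simp [piecewise, h]

theorem piecewise_level_of_notMem (h : t ∉ B) :
    (piecewise B hB T₁ T₂).level t = T₂.level t := by
  simp [piecewise, h]

end Schedule

namespace Instance

variable {n k L : ℕ} {M : Instance n k} {S S' : Schedule n k} {τ : Fin L → ℝ} {R : ℝ}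

theorem speed_pos {i : Fin (k + 1)} (hi : i ≠ 0) : 0 < M.speed i := by
  rw [← M.speed_zero]
  exact M.speed_strictMono (Fin.pos_of_ne_zero hi)

theorem speed_nonneg (i : Fin (k + 1)) : 0 ≤ M.speed i := by
  by_cases h : i = 0
  · rw [h, M.speed_zero]
  · exact (speed_pos h).le

theorem nonneg_of_job (hS : M.RespectsWindows S) {t : ℝ} {j : Fin n} (h : S.job t = some j) :
    0 ≤ t :=
  (M.release_nonneg j).trans (hS t j h).1

theorem level_ne_zero {t : ℝ} {j : Fin n} (h : S.job t = some j) : S.level t ≠ 0 := by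
  intro h0
  rw [(S.idle_iff t).2 h0] at h
  cases h

/-- A rate that vanishes at speed `0`, such as the speed or the power, is integrable along a
schedule that is busy only in the windows of the jobs. -/
theorem integrable_level (hS : M.RespectsWindows S) (f : Fin (k + 1) → ℝ) (hf : f 0 = 0) :
    Integrable (fun t => f (S.level t)) := by
  have hU : MeasurableSet (⋃ j, M.window j) := MeasurableSet.iUnion fun j => measurableSet_Ico
  have hvol : volume (⋃ j, M.window j) < ⊤ := by
    refine (measure_iUnion_fintype_le _ _).trans_lt ?_
    exact ENNReal.sum_lt_top.2 fun j _ => by simp [window]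
  have hmeas : Measurable fun t => f (S.level t) :=
    (measurable_of_finite f).comp S.measurable_level
  have hind : (fun t => f (S.level t)) = (⋃ j, M.window j).indicator fun t => f (S.level t) := by
    symm
    rw [Set.indicator_eq_self]
    intro t ht
    rw [Function.mem_support] at ht
    rcases hj : S.job t with _ | j
    · rw [(S.idle_iff t).1 hj] at ht
      exact absurd hf ht
    · exact mem_iUnion.2 ⟨j, hS t j hj⟩
  rw [hind, integrable_indicator_iff hU]
  refine Measure.integrableOn_of_bounded (M := ∑ i, |f i|) hvol.ne
    hmeas.aestronglyMeasurable (Filter.Eventually.of_forall fun t => ?_)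
  rw [Real.norm_eq_abs]
  exact Finset.single_le_sum (f := fun i => |f i|) (fun i _ => abs_nonneg _) (Finset.mem_univ _)

theorem integrable_speed (hS : M.RespectsWindows S) :
    Integrable (fun t => M.speed (S.level t)) := integrable_level hS _ M.speed_zero

theorem integrable_power (hS : M.RespectsWindows S) :
    Integrable (fun t => M.power (S.level t)) := integrable_level hS _ M.power_zero

theorem work_nonneg (M : Instance n k) (S : Schedule n k) (j : Fin n) (A : Set ℝ) :
    0 ≤ M.work S j A :=
  integral_nonneg fun _ => speed_nonneg _

/-- The processed work is positive exactly when the processing time is. -/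
theorem work_pos_iff (hS : M.RespectsWindows S) (j : Fin n) {A : Set ℝ} :
    0 < M.work S j A ↔ 0 < volume (A ∩ {t | S.job t = some j}) := by
  unfold work
  rw [setIntegral_pos_iff_support_of_nonneg_ae
    (Filter.Eventually.of_forall fun t => speed_nonneg _) (integrable_speed hS).integrableOn,
    inter_eq_right.2]
  intro t ht
  exact (speed_pos (level_ne_zero ht.2)).ne'

theorem work_eq_zero_iff (hS : M.RespectsWindows S) (j : Fin n) {A : Set ℝ} :
    M.work S j A = 0 ↔ volume (A ∩ {t | S.job t = some j}) = 0 := by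
  have h := work_pos_iff hS j (A := A)
  rw [(work_nonneg M S j A).lt_iff_ne', pos_iff_ne_zero] at h
  exact not_iff_not.1 h

theorem work_mono (hS : M.RespectsWindows S) (j : Fin n) {A A' : Set ℝ} (h : A ⊆ A') :
    M.work S j A ≤ M.work S j A' :=
  setIntegral_mono_set (integrable_speed hS).integrableOn
    (Filter.Eventually.of_forall fun _ => speed_nonneg _)
    (Filter.Eventually.of_forall (inter_subset_inter_left _ h))

theorem volume_job_lt_top (hS : M.RespectsWindows S) (j : Fin n) (A : Set ℝ) :
    volume (A ∩ {t | S.job t = some j}) < ⊤ := by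
  refine (measure_mono (t := M.window j) fun t ht => hS t j ht.2).trans_lt ?_
  simp [window]

theorem sum_work_interval (hS : M.RespectsWindows S) (hτ : StrictMono τ) (j : Fin n) :
    ∑ ℓ, M.work S j (interval τ ℓ) = M.work S j univ := by
  unfold work
  rw [← integral_iUnion_fintype]
  · congr 2
    ext t
    simp only [mem_iUnion, mem_inter_iff, mem_univ, true_and, exists_and_right,
      mem_ofPred_eq, and_iff_right_iff_imp]
    intro ht
    exact exists_mem_interval hτ (nonneg_of_job hS ht)
  · exact fun ℓ => (measurableSet_interval τ ℓ).inter (S.measurableSet_job j)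
  · intro ℓ ℓ' h
    refine Set.disjoint_left.2 fun t ht ht' => h (eq_of_mem_interval ht.1 ht'.1)
  · exact fun ℓ => (integrable_speed hS).integrableOn

theorem activeIn_of_processedIn (hS : M.RespectsWindows S) {j : Fin n} {ℓ : Fin (L + 1)}
    (h : M.ProcessedIn S τ j ℓ) : M.ActiveIn τ j ℓ := by
  obtain ⟨t, ht⟩ := nonempty_of_measure_ne_zero ((work_pos_iff hS j).1 h).ne'
  exact ⟨t, ht.1, hS t j ht.2⟩

/-! ### Inserting a job into an EDF schedule -/

section Insertion

open Filter Topology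

variable {T : Schedule n k} {A : Fin n → Fin (L + 1) → Prop}

/-- The EDF schedule in `WeakEDF` can be chosen so that it runs no job during a null set of times
only. -/
theorem WeakEDF.exists_clean (h : M.WeakEDF τ A) :
    ∃ T : Schedule n k, M.RespectsWindows T ∧ M.IsEDF T ∧
      (∀ j ℓ, M.ProcessedIn T τ j ℓ ↔ A j ℓ) ∧
      ∀ t j ℓ, T.job t = some j → t ∈ interval τ ℓ → A j ℓ := by
  obtain ⟨T, hT, hE, hA⟩ := h
  set B : Set ℝ := ⋃ p : {p : Fin n × Fin (L + 1) // ¬ A p.1 p.2},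
    interval τ p.1.2 ∩ {t | T.job t = some p.1.1} with hBdef
  have hB : MeasurableSet B := MeasurableSet.iUnion fun p =>
    (measurableSet_interval τ _).inter (T.measurableSet_job _)
  have hB0 : volume B = 0 := by
    refine measure_iUnion_null fun p => ?_
    rw [← work_eq_zero_iff hT (M := M)]
    have h1 := mt (hA p.1.1 p.1.2).1 p.2
    exact le_antisymm (not_lt.1 h1) (work_nonneg _ _ _ _)
  have hjob : ∀ t j, (Schedule.piecewise B hB (Schedule.idle n k) T).job t = some j ↔
      T.job t = some j ∧ t ∉ B := by
    intro t j
    by_cases ht : t ∈ B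
    · rw [Schedule.piecewise_job_of_mem _ _ _ ht]
      simp [Schedule.idle, ht]
    · rw [Schedule.piecewise_job_of_notMem _ _ _ ht]
      simp [ht]
  have hW : M.RespectsWindows (Schedule.piecewise B hB (Schedule.idle n k) T) :=
    fun t j ht => hT t j ((hjob t j).1 ht).1
  refine ⟨_, hW, ?_, ?_, ?_⟩
  · intro t t' q j h1 h2 h3 h4
    exact hE t t' q j ((hjob _ _).1 h1).1 h2 ((hjob _ _).1 h3).1 h4
  · intro j ℓ
    rw [← hA j ℓ]
    unfold ProcessedIn
    rw [work_pos_iff hT, work_pos_iff hW]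
    have : interval τ ℓ ∩ {t | (Schedule.piecewise B hB (Schedule.idle n k) T).job t = some j}
        = (interval τ ℓ ∩ {t | T.job t = some j}) \ B := by
      ext t
      simp only [mem_inter_iff, mem_ofPred_eq, hjob, Set.mem_sdiff, and_assoc]
    rw [this, measure_sdiff_null hB0]
  · intro t j ℓ h1 h2
    obtain ⟨h3, h4⟩ := (hjob _ _).1 h1
    by_contra hc
    exact h4 (mem_iUnion.2 ⟨⟨(j, ℓ), hc⟩, h2, h3⟩)

/-- Running `q` during `[t₁, t₂)` instead of whatever `T` runs there keeps EDF if `T` runs only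
jobs with deadlines up to that of `q` between the release of `q` and `t₁`, and if the jobs that
are released before `t₂` and still run afterwards have deadlines from that of `q` on. When
`[t₁, t₂)` is short, no job disappears from a depletion interval. -/
theorem weakEDF_insert (hT : M.RespectsWindows T) (hE : M.IsEDF T)
    (hA : ∀ j ℓ, M.ProcessedIn T τ j ℓ ↔ A j ℓ) {q : Fin n} (hq : ∃ t, T.job t = some q)
    {ℓ' : Fin (L + 1)} {t₁ t₂ : ℝ} (h12 : t₁ < t₂) (hwin : Ico t₁ t₂ ⊆ M.window q)
    (hint : Ico t₁ t₂ ⊆ interval τ ℓ')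
    (hshort : ∀ j ℓ, A j ℓ →
      ENNReal.ofReal (t₂ - t₁) < volume (interval τ ℓ ∩ {t | T.job t = some j}))
    (hbefore : ∀ t j, M.release q ≤ t → t < t₁ → T.job t = some j → M.deadline j ≤ M.deadline q)
    (hafter : ∀ t j, t₂ ≤ t → T.job t = some j → M.release j < t₂ →
      M.deadline q ≤ M.deadline j) :
    M.WeakEDF τ fun j ℓ => A j ℓ ∨ (j = q ∧ ℓ = ℓ') := by
  obtain ⟨t₀, ht₀⟩ := hq
  set B : Set ℝ := Ico t₁ t₂ with hBdef
  have hB : MeasurableSet B := measurableSet_Ico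
  set T' := Schedule.piecewise B hB (Schedule.run q (T.level t₀) (level_ne_zero ht₀)) T with hT'
  have hin : ∀ t ∈ B, T'.job t = some q := fun t ht => by
    rw [hT', Schedule.piecewise_job_of_mem _ _ _ ht]; rfl
  have hout : ∀ t, t ∉ B → T'.job t = T.job t := fun t ht => by
    rw [hT', Schedule.piecewise_job_of_notMem _ _ _ ht]
  have hW : M.RespectsWindows T' := by
    intro t j ht
    by_cases h : t ∈ B
    · rw [hin t h, Option.some.injEq] at ht
      exact ht ▸ hwin h
    · exact hT t j (by rwa [hout t h] at ht)
  refine ⟨T', hW, ?_, ?_⟩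
  · intro t t' p j hp htt hj hr
    by_cases h : t ∈ B <;> by_cases h' : t' ∈ B
    · rw [hin _ h, Option.some.injEq] at hp
      rw [hin _ h', Option.some.injEq] at hj
      rw [← hp, ← hj]
    · rw [hin _ h, Option.some.injEq] at hp
      rw [hout _ h'] at hj
      have h3 : t₂ ≤ t' := by
        by_contra! hc
        exact h' ⟨h.1.trans htt.le, hc⟩
      rw [← hp]
      exact hafter t' j h3 hj (hr.trans_lt h.2)
    · rw [hout _ h] at hp
      rw [hin _ h', Option.some.injEq] at hj
      subst hj
      refine hbefore t p hr ?_ hp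
      by_contra! hc
      exact h ⟨hc, htt.trans h'.2⟩
    · rw [hout _ h] at hp
      rw [hout _ h'] at hj
      exact hE t t' p j hp htt hj hr
  · intro j ℓ
    unfold ProcessedIn
    rw [work_pos_iff hW]
    constructor
    · intro hpos
      by_contra! hc
      have h0 : volume (interval τ ℓ ∩ {t | T.job t = some j}) = 0 := by
        by_contra h1
        exact hc.1 ((hA j ℓ).1 ((work_pos_iff hT j).2 (pos_iff_ne_zero.2 h1)))
      refine hpos.ne' (measure_mono_null ?_ h0)
      rintro t ⟨h1, h2⟩
      refine ⟨h1, ?_⟩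
      by_cases h : t ∈ B
      · have h3 : T'.job t = some j := h2
        rw [hin t h, Option.some.injEq] at h3
        exact absurd (eq_of_mem_interval h1 (hint h)) (hc.2 h3.symm)
      · have h3 : T'.job t = some j := h2
        rwa [hout t h] at h3
    · rintro (h | ⟨rfl, rfl⟩)
      · have h1 : 0 < volume ((interval τ ℓ ∩ {t | T.job t = some j}) \ B) := by
          refine (tsub_pos_of_lt ?_).trans_le (le_measure_sdiff (s₂ := B))
          rw [hBdef, Real.volume_Ico]
          exact hshort j ℓ h
        refine h1.trans_le (measure_mono ?_)
        rintro t ⟨⟨h2, h3⟩, h4⟩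
        exact ⟨h2, (hout t h4).trans h3⟩
      · refine lt_of_lt_of_le ?_ (measure_mono (s := B) fun t ht => ⟨hint ht, hin t ht⟩)
        rw [hBdef, Real.volume_Ico]
        simpa using h12

theorem eventually_ofReal_lt_volume (hT : M.RespectsWindows T)
    (hA : ∀ j ℓ, M.ProcessedIn T τ j ℓ ↔ A j ℓ) {F : Filter ℝ} {f : ℝ → ℝ}
    (hf : Tendsto f F (𝓝 0)) :
    ∀ᶠ u in F, ∀ j ℓ, A j ℓ →
      ENNReal.ofReal (f u) < volume (interval τ ℓ ∩ {t | T.job t = some j}) := by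
  refine eventually_all.2 fun j => eventually_all.2 fun ℓ => ?_
  by_cases h : A j ℓ
  · have h1 := (work_pos_iff hT j).1 ((hA j ℓ).2 h)
    have h2 := ENNReal.tendsto_ofReal hf
    rw [ENNReal.ofReal_zero] at h2
    filter_upwards [h2.eventually_lt_const h1] with u hu _ using hu
  · exact Eventually.of_forall fun u hu => absurd hu h

/-- `q` can be inserted immediately after the time `t₀` if EDF runs no job with a later deadline
between the release of `q` and `t₀`, and has no released job with an earlier deadline left. -/
theorem weakEDF_insert_right (hT : M.RespectsWindows T) (hE : M.IsEDF T)
    (hA : ∀ j ℓ, M.ProcessedIn T τ j ℓ ↔ A j ℓ) {q : Fin n} (hq : ∃ t, T.job t = some q)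
    {ℓ' : Fin (L + 1)} {t₀ : ℝ} (ht₀ : t₀ ∈ interval τ ℓ') (hwin : t₀ ∈ M.window q)
    (hbefore : ∀ t j, M.release q ≤ t → t < t₀ → T.job t = some j → M.deadline j ≤ M.deadline q)
    (hafter : ∀ t j, t₀ < t → T.job t = some j → M.release j ≤ t₀ →
      M.deadline q ≤ M.deadline j) :
    M.WeakEDF τ fun j ℓ => A j ℓ ∨ (j = q ∧ ℓ = ℓ') := by
  have key : ∀ a : ℝ, ∀ᶠ u in 𝓝[>] t₀, t₀ < a → u ≤ a := by
    intro a
    by_cases h : t₀ < a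
    · filter_upwards [Ioc_mem_nhdsGT h] with u hu _ using hu.2
    · exact Eventually.of_forall fun u hu => absurd hu h
  have hlim : Tendsto (fun u => u - t₀) (𝓝[>] t₀) (𝓝 0) := by
    have : Tendsto (fun u => u - t₀) (𝓝 t₀) (𝓝 (t₀ - t₀)) :=
      tendsto_id.sub_const t₀
    rw [sub_self] at this
    exact this.mono_left nhdsWithin_le_nhds
  obtain ⟨u, hu, hd, hτ, hr, hs⟩ := ((eventually_mem_nhdsWithin (a := t₀) (s := Ioi t₀)).and
    ((key (M.deadline q)).and ((eventually_all.2 fun i => key (τ i)).and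
    ((eventually_all.2 fun j => key (M.release j)).and
      (eventually_ofReal_lt_volume hT hA hlim))))).exists
  refine weakEDF_insert hT hE hA hq (t₁ := t₀) (t₂ := u) hu ?_ ?_ hs hbefore ?_
  · exact fun t ht => ⟨hwin.1.trans ht.1, ht.2.trans_le (hd hwin.2)⟩
  · exact fun t ht => ⟨ht₀.1.trans ht.1, fun i hi => (ht₀.2.1 i hi).trans ht.1,
      fun i hi => ht.2.trans_le (hτ i (ht₀.2.2 i hi))⟩
  · intro t j ht hj hr'
    refine hafter t j (lt_of_lt_of_le hu ht) hj ?_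
    by_contra! hc
    exact absurd (hr j hc) (not_le.2 hr')

/-- The counterpart of `weakEDF_insert_right` for the end of the depletion interval left of `τ i`.
There, jobs with earlier deadlines may be released and unfinished before `τ i`, as long as none of
them runs from `τ i` on: the inserted piece replaces whatever was run just before `τ i`. -/
theorem weakEDF_insert_left (hT : M.RespectsWindows T) (hE : M.IsEDF T)
    (hA : ∀ j ℓ, M.ProcessedIn T τ j ℓ ↔ A j ℓ) {q : Fin n} (hq : ∃ t, T.job t = some q)
    (hτ : StrictMono τ) {i : Fin L} (hi : 0 < τ i) (hrel : M.release q < τ i)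
    (hdead : τ i ≤ M.deadline q)
    (hbefore : ∀ t j, M.release q ≤ t → t < τ i → T.job t = some j →
      M.deadline j ≤ M.deadline q)
    (hafter : ∀ t j, τ i ≤ t → T.job t = some j → M.release j < τ i →
      M.deadline q ≤ M.deadline j) :
    M.WeakEDF τ fun j ℓ => A j ℓ ∨ (j = q ∧ ℓ = i.castSucc) := by
  have key : ∀ a : ℝ, ∀ᶠ u in 𝓝[<] (τ i), a < τ i → a ≤ u := by
    intro a
    by_cases h : a < τ i
    · filter_upwards [Ico_mem_nhdsLT h] with u hu _ using hu.1
    · exact Eventually.of_forall fun u hu => absurd hu h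
  have hlim : Tendsto (fun u => τ i - u) (𝓝[<] (τ i)) (𝓝 0) := by
    have : Tendsto (fun u => τ i - u) (𝓝 (τ i)) (𝓝 (τ i - τ i)) :=
      tendsto_id.const_sub (τ i)
    rw [sub_self] at this
    exact this.mono_left nhdsWithin_le_nhds
  obtain ⟨u, hu, h0, hr, hτu, hs⟩ := ((eventually_mem_nhdsWithin (a := τ i) (s := Iio (τ i))).and
    ((key 0).and ((key (M.release q)).and ((eventually_all.2 fun i' => key (τ i')).and
      (eventually_ofReal_lt_volume hT hA hlim))))).exists
  refine weakEDF_insert hT hE hA hq (t₁ := u) (t₂ := τ i) hu ?_ ?_ hs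
    (fun t j h1 h2 => hbefore t j h1 (h2.trans hu)) hafter
  · exact fun t ht => ⟨(hr hrel).trans ht.1, ht.2.trans_le hdead⟩
  · refine fun t ht => ⟨(h0 hi).trans ht.1, fun i' hi' => (hτu i' (hτ ?_)).trans ht.1,
      fun i' hi' => ht.2.trans_le (hτ.monotone ?_)⟩
    · exact hi'
    · exact hi'

end Insertion

/-! ### One-step transfers and the stuck intervals -/

/-- Half of the work of `q` in the interval `ℓ` can be moved to `ℓ'` if weak EDF survives the
addition of `q` to `ℓ'`; there are no intermediate intervals whose speeds matter. -/
theorem transferEdge_of_weakEDF {R : ℝ} (hS : M.Perfect S R τ) {q : Fin n} {ℓ ℓ' : Fin (L + 1)}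
    (hne : ℓ ≠ ℓ') (hq : M.ProcessedIn S τ q ℓ) (hact : M.ActiveIn τ q ℓ')
    (hEDF : M.WeakEDF τ fun j m => M.ProcessedIn S τ j m ∨ (j = q ∧ m = ℓ')) :
    M.TransferEdge S τ ℓ ℓ' := by
  have hq' : 0 < M.work S q (interval τ ℓ) := hq
  have hW := hS.feasible.2.1
  have hout : ∀ j m, outflow ![ℓ, ℓ'] ![q] (fun _ => M.work S q (interval τ ℓ) / 2) j m =
      if q = j ∧ ℓ = m then M.work S q (interval τ ℓ) / 2 else 0 := by
    intro j m
    simp [outflow]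
    congr
  have hinf : ∀ j m, inflow ![ℓ, ℓ'] ![q] (fun _ => M.work S q (interval τ ℓ) / 2) j m =
      if q = j ∧ ℓ' = m then M.work S q (interval τ ℓ) / 2 else 0 := by
    intro j m
    simp [inflow]
  have hpos : ∀ j m, 0 < M.work S j (interval τ m)
        - outflow ![ℓ, ℓ'] ![q] (fun _ => M.work S q (interval τ ℓ) / 2) j m
        + inflow ![ℓ, ℓ'] ![q] (fun _ => M.work S q (interval τ ℓ) / 2) j m ↔
      M.ProcessedIn S τ j m ∨ (j = q ∧ m = ℓ') := by
    intro j m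
    have h0 := work_nonneg M S j (interval τ m)
    rw [hout, hinf]
    unfold ProcessedIn
    by_cases h1 : q = j ∧ ℓ = m
    · obtain ⟨rfl, rfl⟩ := h1
      have : ¬ (ℓ' = ℓ) := fun h => hne h.symm
      simp only [and_self, if_true, this, and_false, if_false, hq', true_or, iff_true]
      linarith
    · by_cases h2 : q = j ∧ ℓ' = m
      · obtain ⟨rfl, rfl⟩ := h2
        simp only [and_self, if_true, hne, and_false, if_false, or_true, iff_true]
        linarith
      · have h3 : ¬ (j = q ∧ m = ℓ') := fun h => h2 ⟨h.1.symm, h.2.symm⟩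
        simp [h1, h2, h3]
  refine ⟨1, ![ℓ, ℓ'], ![q], ⟨Nat.one_pos, ?_, fun _ => M.work S q (interval τ ℓ) / 2, ?_, ?_,
    ⟨?_, ?_, ?_, ?_⟩, ?_⟩, rfl, rfl⟩
  · intro a
    fin_cases a
    exact hne
  · exact fun _ => half_pos hq'
  · intro j m
    rw [hout]
    split_ifs with h
    · obtain ⟨rfl, rfl⟩ := h
      linarith
    · exact work_nonneg _ _ _ _
  · intro j m
    have h0 := work_nonneg M S j (interval τ m)
    beta_reduce
    rw [hout, hinf]
    by_cases h1 : q = j ∧ ℓ = m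
    · obtain ⟨rfl, rfl⟩ := h1
      split_ifs <;> linarith
    · simp only [h1, if_false]
      split_ifs <;> linarith
  · intro j m h
    rcases (hpos j m).1 h with h | ⟨rfl, rfl⟩
    · exact activeIn_of_processedIn hW h
    · exact hact
  · intro j
    rw [Finset.sum_add_distrib, Finset.sum_sub_distrib, sum_work_interval hW hS.depletion.1,
      hS.exact_work]
    simp only [hout, hinf]
    by_cases h : q = j <;> simp [h]
  · exact (funext₂ fun j m => propext (hpos j m)) ▸ hEDF
  · intro b hb hb'
    fin_cases b
    · exact absurd rfl hb
    · exact absurd rfl hb'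

theorem exists_job_mem_interval {T : Schedule n k} (hT : M.RespectsWindows T) {j : Fin n}
    {ℓ : Fin (L + 1)} (h : M.ProcessedIn T τ j ℓ) : ∃ t ∈ interval τ ℓ, T.job t = some j :=
  nonempty_of_measure_ne_zero ((work_pos_iff hT j).1 h).ne'

/-- If some job processed to the right of `τ i` is released before `τ i`, then the one with the
earliest deadline can be transferred across `τ i`: it may run right before `τ i`, because EDF
completes the released jobs with earlier deadlines by then. -/
theorem transferEdge_of_not_mergeable (hS : M.Perfect S R τ) {i : Fin L}
    (hi : ¬ M.Mergeable S τ i) : M.TransferEdge S τ i.succ i.castSucc := by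
  classical
  obtain ⟨T, hT, hE, hA, hclean⟩ := hS.weakEDF.exists_clean
  have hτ := hS.depletion.1
  have hτi := (hS.depletion.2 i).1
  unfold Mergeable at hi
  push Not at hi
  obtain ⟨q, hq, hmin⟩ := Finset.exists_min_image
    (Finset.univ.filter fun j => M.ProcessedIn S τ j i.succ ∧ M.release j < τ i) M.deadline
    (by obtain ⟨j, hj⟩ := hi; exact ⟨j, by simpa using hj⟩)
  simp only [Finset.mem_filter, Finset.mem_univ, true_and] at hq hmin
  obtain ⟨t₀, ht₀, hjt₀⟩ := exists_job_mem_interval hT ((hA _ _).2 hq.1)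
  have ht₀i : τ i ≤ t₀ := ht₀.2.1 i (by simp)
  have hdead : τ i < M.deadline q := ht₀i.trans_lt (hT t₀ q hjt₀).2
  refine transferEdge_of_weakEDF hS (Fin.castSucc_lt_succ (i := i)).ne' hq.1 ?_
    (weakEDF_insert_left hT hE hA ⟨t₀, hjt₀⟩ hτ hτi hq.2 hdead.le ?_ ?_)
  · obtain ⟨t, ht1, ht2⟩ := exists_between (max_lt hq.2 hτi)
    -- a time shortly before `τ i` lies in the left interval and in the window of `q`
    have hwin : ∃ t ∈ interval τ i.castSucc, M.release q ≤ t ∧ t < τ i := by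
      obtain ⟨u, hu⟩ : ∃ u, u < τ i ∧ M.release q ≤ u ∧ 0 ≤ u ∧ ∀ i' < i, τ i' ≤ u := by
        by_cases h : ∃ i', i' < i
        · obtain ⟨i', hi', hmax⟩ := Finset.exists_max_image
            (Finset.univ.filter fun i' => i' < i) τ
            (by obtain ⟨i', h⟩ := h; exact ⟨i', by simpa using h⟩)
          simp only [Finset.mem_filter, Finset.mem_univ, true_and] at hi' hmax
          exact ⟨max t (τ i'), max_lt ht2 (hτ hi'),
            (le_max_left _ _).trans (ht1.le.trans (le_max_left _ _)),
            (le_max_right _ _).trans (ht1.le.trans (le_max_left _ _)),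
            fun i'' h'' => (hmax i'' h'').trans (le_max_right _ _)⟩
        · push Not at h
          exact ⟨t, ht2, (le_max_left _ _).trans ht1.le, (le_max_right _ _).trans ht1.le,
            fun i' h' => absurd h' (not_lt.2 (h i'))⟩
      exact ⟨u, ⟨hu.2.2.1, fun i' h' => hu.2.2.2 i' h',
        fun i' h' => hu.1.trans_le (hτ.monotone h')⟩, hu.2.1, hu.1⟩
    obtain ⟨u, hu1, hu2, hu3⟩ := hwin
    exact ⟨u, hu1, hu2, hu3.trans hdead⟩
  · intro t j hr ht hj
    exact hE t t₀ j q hj (ht.trans_le ht₀i) hjt₀ hr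
  · intro t j ht hj hr
    obtain ⟨ℓ, hℓ⟩ := exists_mem_interval hτ (hτi.le.trans ht)
    have hle : i.succ ≤ ℓ := by
      have := (lt_iff_le_castSucc hℓ i).not.1 (not_lt.2 ht)
      rw [Fin.le_def]
      rw [Fin.le_def] at this
      simp only [Fin.val_castSucc] at this
      simp only [Fin.val_succ]
      omega
    rcases hle.eq_or_lt with rfl | hlt
    · exact hmin j ⟨hclean t j _ hj hℓ, hr⟩
    · exact hE t₀ t q j hjt₀ (lt_of_mem_interval ht₀ hℓ hlt) hj (hr.le.trans ht₀i)

/-- From the stuck intervals, no job with a deadline after the last of them is processed: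
otherwise the one with the latest deadline could be transferred to an interval that is not stuck.
It is inserted where EDF first runs a job with a later deadline, or else, after the last stuck
interval, where EDF has completed all released jobs with earlier deadlines. -/
theorem deadline_le_of_stuck (hS : M.Perfect S R τ) {i : Fin L}
    (hright : ∀ ℓ, i.castSucc < ℓ → M.ReachesRightmost S τ ℓ) {j₀ : Fin n} {m₀ : Fin (L + 1)}
    (hm₀ : ¬ M.ReachesRightmost S τ m₀) (hj₀ : M.ProcessedIn S τ j₀ m₀) :
    M.deadline j₀ ≤ τ i := by
  classical
  obtain ⟨T, hT, hE, hA, hclean⟩ := hS.weakEDF.exists_clean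
  have hτ := hS.depletion.1
  have hτi := (hS.depletion.2 i).1
  by_contra! hlate
  obtain ⟨q, hq, hmax⟩ := Finset.exists_max_image
    (Finset.univ.filter fun j => ∃ m, ¬ M.ReachesRightmost S τ m ∧ M.ProcessedIn S τ j m)
    M.deadline ⟨j₀, by simpa using ⟨m₀, hm₀, hj₀⟩⟩
  simp only [Finset.mem_filter, Finset.mem_univ, true_and] at hq hmax
  obtain ⟨m, hm, hqm⟩ := hq
  have hdq : τ i < M.deadline q := hlate.trans_le (hmax j₀ ⟨m₀, hm₀, hj₀⟩)
  obtain ⟨t₀, ht₀, hjt₀⟩ := exists_job_mem_interval hT ((hA _ _).2 hqm)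
  have hrq : M.release q ≤ τ i := by
    refine (hT t₀ q hjt₀).1.trans ?_
    refine le_of_lt ((lt_iff_le_castSucc ht₀ i).2 ?_)
    by_contra! hc
    exact hm (hright m hc)
  -- it suffices to find a point outside the stuck intervals at which `q` can be inserted
  suffices h : ∃ (p : ℝ) (ℓ : Fin (L + 1)), p ∈ interval τ ℓ ∧ M.ReachesRightmost S τ ℓ ∧
      p ∈ M.window q ∧
      (∀ t j, M.release q ≤ t → t < p → T.job t = some j → M.deadline j ≤ M.deadline q) ∧
      (∀ t j, p < t → T.job t = some j → M.release j ≤ p → M.deadline q ≤ M.deadline j) by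
    obtain ⟨p, ℓ, hp, hreach, hwin, hbefore, hafter⟩ := h
    have hne : m ≠ ℓ := fun h => hm (h ▸ hreach)
    exact hm (Relation.ReflTransGen.head (transferEdge_of_weakEDF hS hne hqm ⟨p, hp, hwin⟩
      (weakEDF_insert_right hT hE hA ⟨t₀, hjt₀⟩ hp hwin hbefore hafter)) hreach)
  set V : Set ℝ := {t | M.release q ≤ t ∧ t < τ i ∧
    ∃ j, T.job t = some j ∧ M.deadline q < M.deadline j} with hV
  by_cases hVne : V.Nonempty
  · have hbdd : BddBelow V := ⟨M.release q, fun t ht => ht.1⟩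
    obtain ⟨v₀, hv₀⟩ := hVne
    have hlow : M.release q ≤ sInf V := le_csInf ⟨v₀, hv₀⟩ fun t ht => ht.1
    have hlt : sInf V < τ i := (csInf_le hbdd hv₀).trans_lt hv₀.2.1
    obtain ⟨ℓ, hℓ⟩ := exists_mem_interval hτ ((M.release_nonneg q).trans hlow)
    refine ⟨sInf V, ℓ, hℓ, ?_, ⟨hlow, hlt.trans hdq⟩, ?_, ?_⟩
    · -- there are points of `V` in the same interval, and they are not in stuck intervals
      obtain ⟨v, hv, hvℓ⟩ : ∃ v ∈ V, v ∈ interval τ ℓ := by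
        by_cases hℓL : ℓ.val < L
        · obtain ⟨v, hv, hvlt⟩ := exists_lt_of_csInf_lt ⟨v₀, hv₀⟩ (hℓ.2.2 ⟨ℓ, hℓL⟩ le_rfl)
          exact ⟨v, hv, hℓ.1.trans (csInf_le hbdd hv),
            fun i' h' => (hℓ.2.1 i' h').trans (csInf_le hbdd hv),
            fun i' h' => hvlt.trans_le (hτ.monotone h')⟩
        · exact ⟨v₀, hv₀, hℓ.1.trans (csInf_le hbdd hv₀),
            fun i' h' => (hℓ.2.1 i' h').trans (csInf_le hbdd hv₀),
            fun i' h' => absurd (h'.trans_lt i'.isLt) hℓL⟩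
      obtain ⟨j, hj, hdj⟩ := hv.2.2
      by_contra hc
      exact absurd (hmax j ⟨ℓ, hc, hclean v j ℓ hj hvℓ⟩) (not_le.2 hdj)
    · intro t j hr ht hj
      by_contra! hc
      exact absurd (csInf_le hbdd ⟨hr, ht.trans hlt, j, hj, hc⟩) (not_le.2 ht)
    · intro t j ht hj hr
      obtain ⟨v, hv, hvt⟩ := exists_lt_of_csInf_lt ⟨v₀, hv₀⟩ ht
      obtain ⟨p, hp, hdp⟩ := hv.2.2
      exact hdp.le.trans (hE v t p j hp hvt hj (hr.trans (csInf_le hbdd hv)))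
  · set G : Set ℝ := {t | τ i ≤ t ∧
      ∀ t' j, t ≤ t' → T.job t' = some j → M.release j ≤ t → M.deadline q ≤ M.deadline j} with hG
    have hbdd : BddBelow G := ⟨τ i, fun t ht => ht.1⟩
    -- after the latest deadline before that of `q`, no job with an earlier deadline runs
    obtain ⟨g, hg, hgq⟩ : ∃ g ∈ G, g < M.deadline q := by
      by_cases h : ∃ j, M.deadline j < M.deadline q
      · obtain ⟨j', hj', hmaxj'⟩ := Finset.exists_max_image
          (Finset.univ.filter fun j => M.deadline j < M.deadline q) M.deadline
          (by obtain ⟨j, h⟩ := h; exact ⟨j, by simpa using h⟩)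
        simp only [Finset.mem_filter, Finset.mem_univ, true_and] at hj' hmaxj'
        refine ⟨max (τ i) (M.deadline j'), ⟨le_max_left _ _, fun t j ht hj _ => ?_⟩,
          max_lt hdq hj'⟩
        by_contra! hc
        exact absurd ((hT t j hj).2.trans_le (hmaxj' j hc))
          (not_lt.2 ((le_max_right _ _).trans ht))
      · push Not at h
        exact ⟨τ i, ⟨le_rfl, fun t j _ _ _ => h j⟩, hdq⟩
    have hlow : τ i ≤ sInf G := le_csInf ⟨g, hg⟩ fun t ht => ht.1
    obtain ⟨ℓ, hℓ⟩ := exists_mem_interval hτ (hτi.le.trans hlow)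
    refine ⟨sInf G, ℓ, hℓ, hright ℓ ?_, ⟨hrq.trans hlow, (csInf_le hbdd hg).trans_lt hgq⟩, ?_, ?_⟩
    · by_contra! hc
      exact absurd ((lt_iff_le_castSucc hℓ i).2 hc) (not_lt.2 hlow)
    · intro t j hr ht hj
      by_cases hti : t < τ i
      · by_contra! hc
        exact hVne ⟨t, hr, hti, j, hj, hc⟩
      · have hnot : t ∉ G := fun h => absurd (csInf_le hbdd h) (not_le.2 ht)
        simp only [hG, mem_ofPred_eq, not_and, not_forall, not_le] at hnot
        obtain ⟨t', j', htt', hj', hr', hd'⟩ := hnot (not_lt.1 hti)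
        rcases htt'.eq_or_lt with rfl | hlt
        · rw [hj, Option.some.injEq] at hj'
          exact hj' ▸ hd'.le
        · exact (hE t t' j j' hj hlt hj' hr').trans hd'.le
    · intro t j ht hj hr
      obtain ⟨g', hg', hgt⟩ := exists_lt_of_csInf_lt ⟨g, hg⟩ ht
      exact hg'.2 t j hgt.le hj (hr.trans (csInf_le hbdd hg'))

/-- A stuck interval passes the property of being stuck on to its left neighbour, so the stuck
intervals are all those up to the last one, whose end is a split depletion point. -/
theorem exists_isSplitPoint (hS : M.Perfect S R τ)
    (hmerge : ∀ i : Fin L, ¬ M.ReachesRightmost S τ i.succ → ¬ M.Mergeable S τ i)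
    {ℓ₀ : Fin (L + 1)} (hcut : ¬ M.ReachesRightmost S τ ℓ₀) :
    ∃ i : Fin L, M.IsSplitPoint S τ i := by
  classical
  obtain ⟨m, hm, hmax⟩ := Finset.exists_max_image
    (Finset.univ.filter fun ℓ => ¬ M.ReachesRightmost S τ ℓ) id ⟨ℓ₀, by simpa using hcut⟩
  simp only [Finset.mem_filter, Finset.mem_univ, true_and, id] at hm hmax
  obtain ⟨i, rfl⟩ : ∃ i : Fin L, i.castSucc = m :=
    Fin.exists_castSucc_eq.2 fun h => hm (h ▸ Relation.ReflTransGen.refl)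
  have hright : ∀ ℓ, i.castSucc < ℓ → M.ReachesRightmost S τ ℓ := by
    intro ℓ hℓ
    by_contra hc
    exact absurd (hmax ℓ hc) (not_le.2 hℓ)
  have hdown : ∀ (d : ℕ) (ℓ : Fin (L + 1)), ℓ.val + d = i.val → ¬ M.ReachesRightmost S τ ℓ := by
    intro d
    induction d with
    | zero => intro ℓ hℓ; rwa [show ℓ = i.castSucc from Fin.ext hℓ]
    | succ d ih =>
      intro ℓ hℓ hreach
      have hlt : ℓ.val < L := by omega
      have hstuck : ¬ M.ReachesRightmost S τ (⟨ℓ, hlt⟩ : Fin L).succ :=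
        ih _ (by simp only [Fin.val_succ]; omega)
      exact hstuck (Relation.ReflTransGen.head
        (transferEdge_of_not_mergeable hS (hmerge _ hstuck)) hreach)
  have hW := hS.feasible.2.1
  refine ⟨i, fun j hj => (work_eq_zero_iff hW j).2 ?_⟩
  have hcover : Iio (τ i) ∩ {t | S.job t = some j} ⊆
      ⋃ ℓ : {ℓ : Fin (L + 1) // ℓ ≤ i.castSucc}, interval τ ℓ ∩ {t | S.job t = some j} := by
    rintro t ⟨ht, hjt⟩
    obtain ⟨ℓ, hℓ⟩ := exists_mem_interval hS.depletion.1 (nonneg_of_job hW hjt)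
    exact mem_iUnion.2 ⟨⟨ℓ, (lt_iff_le_castSucc hℓ i).1 ht⟩, hℓ, hjt⟩
  refine measure_mono_null hcover (measure_iUnion_null fun ℓ => ?_)
  rw [← work_eq_zero_iff hW (M := M)]
  refine le_antisymm (not_lt.1 fun hpos => ?_) (work_nonneg _ _ _ _)
  have hstuck := hdown (i.val - ℓ.1.val) ℓ.1 (by have : ℓ.1.val ≤ i.val := ℓ.2; omega)
  exact absurd (deadline_le_of_stuck hS hright hstuck hpos) (not_le.2 hj)

/-! ### Speeds that support a price -/

/-- At the price `y` per unit of work, the speed index `i` maximizes the profit: the line of slope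
`y` through `(s_i, P_i)` lies below all the points `(s_{i'}, P_{i'})`. -/
def Supports (M : Instance n k) (y : ℝ) (i : Fin (k + 1)) : Prop :=
  ∀ i', M.power i - y * M.speed i ≤ M.power i' - y * M.speed i'

/-- The slopes are `a c, a c², …, a c^k`. -/
theorem WellSeparated.exists_geometric (h : M.WellSeparated) :
    ∃ a c : ℝ, 0 < a ∧ 1 < c ∧ ∀ i : Fin k, M.power i.succ - M.power i.castSucc
      = a * c ^ (i.val + 1) * (M.speed i.succ - M.speed i.castSucc) := by
  obtain ⟨c, hc, hslope⟩ := h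
  have hc0 : 0 < c := by linarith
  have hmul : ∀ i : Fin k, M.power i.succ - M.power i.castSucc
      = M.slope i * (M.speed i.succ - M.speed i.castSucc) := by
    intro i
    have : 0 < M.speed i.succ - M.speed i.castSucc :=
      sub_pos.2 (M.speed_strictMono Fin.castSucc_lt_succ)
    rw [slope, div_mul_cancel₀ _ this.ne']
  rcases Nat.eq_zero_or_pos k with rfl | hk
  · exact ⟨1, c, one_pos, hc, fun i => i.elim0⟩
  · have h0 : 0 < M.slope ⟨0, hk⟩ := by
      have h1 : (⟨0, hk⟩ : Fin k).castSucc = 0 := rfl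
      have h2 : (⟨0, hk⟩ : Fin k).succ ≠ 0 := Fin.succ_ne_zero _
      rw [slope, h1, M.power_zero, M.speed_zero, sub_zero, sub_zero]
      exact div_pos (M.power_pos _ h2) (speed_pos h2)
    refine ⟨M.slope ⟨0, hk⟩ / c, c, div_pos h0 hc0, hc, fun i => ?_⟩
    rw [hmul]
    congr 1
    obtain ⟨i, hi⟩ := i
    induction i with
    | zero => field_simp; ring
    | succ i ih =>
      rw [hslope ⟨i, by omega⟩ ⟨i + 1, hi⟩ rfl, ih (by omega)]
      ring

theorem supports_of_adjacent {a c : ℝ} (ha : 0 < a) (hc : 1 < c)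
    (hgeo : ∀ i : Fin k, M.power i.succ - M.power i.castSucc
      = a * c ^ (i.val + 1) * (M.speed i.succ - M.speed i.castSucc))
    {m : ℕ} {i : Fin (k + 1)} (hi : m = i.val ∨ m = i.val + 1) :
    M.Supports (a * c ^ m) i := by
  set h : Fin (k + 1) → ℝ := fun i => M.power i - a * c ^ m * M.speed i with hdef
  have hstep : ∀ i : Fin k, h i.succ - h i.castSucc
      = a * (c ^ (i.val + 1) - c ^ m) * (M.speed i.succ - M.speed i.castSucc) := by
    intro i
    simp only [hdef]
    linear_combination hgeo i
  have hpos : ∀ i : Fin k, 0 < M.speed i.succ - M.speed i.castSucc := fun i =>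
    sub_pos.2 (M.speed_strictMono Fin.castSucc_lt_succ)
  have hup : ∀ i : Fin k, m ≤ i.val + 1 → h i.castSucc ≤ h i.succ := by
    intro i hm
    rw [← sub_nonneg, hstep]
    exact mul_nonneg (mul_nonneg ha.le (sub_nonneg.2 (pow_le_pow_right₀ hc.le hm))) (hpos i).le
  have hdown : ∀ i : Fin k, i.val + 1 ≤ m → h i.succ ≤ h i.castSucc := by
    intro i hm
    rw [← sub_nonpos, hstep]
    exact mul_nonpos_of_nonpos_of_nonneg (mul_nonpos_of_nonneg_of_nonpos ha.le
      (sub_nonpos.2 (pow_le_pow_right₀ hc.le hm))) (hpos i).le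
  have hright : ∀ (d : ℕ) (i' : Fin (k + 1)), i'.val = i.val + d → h i ≤ h i' := by
    intro d
    induction d with
    | zero => intro i' h'; rw [show i' = i from Fin.ext h']
    | succ d ih =>
      intro i' h'
      obtain ⟨p, rfl⟩ := Fin.exists_succ_eq.2 (show i' ≠ 0 by rintro rfl; simp at h')
      simp only [Fin.val_succ] at h'
      exact (ih p.castSucc (by simp only [Fin.val_castSucc]; omega)).trans (hup p (by omega))
  have hleft : ∀ (d : ℕ) (i' : Fin (k + 1)), i'.val + d = i.val → h i ≤ h i' := by
    intro d
    induction d with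
    | zero => intro i' h'; rw [show i' = i from Fin.ext h']
    | succ d ih =>
      intro i' h'
      have hlast : i'.val < k := by have := i.isLt; omega
      have h1 := ih (⟨i', hlast⟩ : Fin k).succ (by simp only [Fin.val_succ]; omega)
      exact h1.trans (hdown ⟨i', hlast⟩ (by simp only; omega))
  intro i'
  rcases le_total i.val i'.val with hle | hle
  · exact hright (i'.val - i.val) i' (by omega)
  · exact hleft (i.val - i'.val) i' (by omega)

/-! ### Local energy optimality forces supported speeds -/

/-- The part of a bounded set to the left of a point has continuous measure. -/
theorem continuous_volume_inter_Iio {B : Set ℝ} (hfin : volume B ≠ ⊤) :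
    Continuous fun u => volume.real (B ∩ Iio u) := by
  have hf : ∀ u, volume (B ∩ Iio u) ≠ ⊤ := fun u => measure_ne_top_of_subset inter_subset_left hfin
  have hmono : ∀ u v, u ≤ v → volume.real (B ∩ Iio u) ≤ volume.real (B ∩ Iio v) := fun u v h =>
    measureReal_mono (inter_subset_inter_right _ (Iio_subset_Iio h)) (hf v)
  have hlip : ∀ u v, u ≤ v →
      volume.real (B ∩ Iio v) ≤ volume.real (B ∩ Iio u) + (v - u) := by
    intro u v h
    have hsub : B ∩ Iio v ⊆ (B ∩ Iio u) ∪ Ico u v := by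
      rintro t ⟨h1, h2⟩
      rcases lt_or_ge t u with h3 | h3
      · exact Or.inl ⟨h1, h3⟩
      · exact Or.inr ⟨h3, h2⟩
    have h1 : volume.real (Ico u v) = v - u := by
      rw [Real.volume_real_Ico_of_le h]
    calc volume.real (B ∩ Iio v) ≤ volume.real ((B ∩ Iio u) ∪ Ico u v) :=
          measureReal_mono hsub (measure_union_ne_top (hf u) (by simp))
      _ ≤ volume.real (B ∩ Iio u) + volume.real (Ico u v) := measureReal_union_le _ _
      _ = _ := by rw [h1]
  refine (LipschitzWith.of_dist_le' (K := 1) fun u v => ?_).continuous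
  rw [Real.dist_eq, Real.dist_eq, one_mul, abs_le]
  rcases le_total u v with h | h
  · rw [abs_of_nonpos (sub_nonpos.2 h)]
    constructor <;> linarith [hmono u v h, hlip u v h]
  · rw [abs_of_nonneg (sub_nonneg.2 h)]
    constructor <;> linarith [hmono v u h, hlip v u h]

/-- If the average speed of `j` in `ℓ` lies between two speeds that support the same price, then
`S` runs `j` in `ℓ` almost always at speeds that support this price: otherwise, running `j` at the
two speeds instead would do the same work with less energy. -/
theorem ae_supports_of_between (hS : M.RespectsWindows S) (hopt : M.LocallyEnergyOptimal S τ)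
    {j : Fin n} {ℓ : Fin (L + 1)} {y : ℝ} {a b : Fin (k + 1)} (ha0 : a ≠ 0) (hb0 : b ≠ 0)
    (ha : M.Supports y a) (hb : M.Supports y b)
    (hlow : M.speed a * volume.real (interval τ ℓ ∩ {t | S.job t = some j})
      ≤ M.work S j (interval τ ℓ))
    (hhigh : M.work S j (interval τ ℓ)
      ≤ M.speed b * volume.real (interval τ ℓ ∩ {t | S.job t = some j})) :
    ∀ᵐ t, t ∈ interval τ ℓ → S.job t = some j → M.Supports y (S.level t) := by
  set B : Set ℝ := interval τ ℓ ∩ {t | S.job t = some j} with hBdef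
  have hA := measurableSet_interval τ ℓ
  have hB : MeasurableSet B := hA.inter (S.measurableSet_job j)
  have hfin : volume B ≠ ⊤ := (volume_job_lt_top hS j _).ne
  have hBwin : B ⊆ Ico (M.release j) (M.deadline j) := fun t ht => hS t j ht.2
  -- the job switches from speed `b` to speed `a` at the time `u`
  obtain ⟨u, -, hu⟩ : ∃ u ∈ Icc (M.release j) (M.deadline j),
      M.speed a * volume.real B + (M.speed b - M.speed a) * volume.real (B ∩ Iio u)
        = M.work S j (interval τ ℓ) := by
    have hcont : Continuous fun u =>
        M.speed a * volume.real B + (M.speed b - M.speed a) * volume.real (B ∩ Iio u) :=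
      continuous_const.add (continuous_const.mul (continuous_volume_inter_Iio hfin))
    refine intermediate_value_Icc (M.release_lt_deadline j).le hcont.continuousOn ⟨?_, ?_⟩
    · have : B ∩ Iio (M.release j) = ∅ := by
        ext t
        simp only [mem_inter_iff, mem_Iio, mem_empty_iff_false, iff_false, not_and, not_lt]
        exact fun ht => (hBwin ht).1
      simpa [this] using hlow
    · have : B ∩ Iio (M.deadline j) = B := inter_eq_left.2 fun t ht => (hBwin ht).2
      rw [this]
      linarith
  have hBu : MeasurableSet (B ∩ Iio u) := hB.inter measurableSet_Iio
  set S' := Schedule.piecewise (B ∩ Iio u) hBu (Schedule.run j b hb0)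
    (Schedule.piecewise B hB (Schedule.run j a ha0) S) with hS'
  have hjob : ∀ t, S'.job t = S.job t := by
    intro t
    by_cases h1 : t ∈ B ∩ Iio u
    · rw [hS', Schedule.piecewise_job_of_mem _ _ _ h1]
      exact h1.1.2.symm
    · rw [hS', Schedule.piecewise_job_of_notMem _ _ _ h1]
      by_cases h2 : t ∈ B
      · rw [Schedule.piecewise_job_of_mem _ _ _ h2]
        exact h2.2.symm
      · rw [Schedule.piecewise_job_of_notMem _ _ _ h2]
  have hlevb : ∀ t ∈ B ∩ Iio u, S'.level t = b := fun t h => by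
    rw [hS', Schedule.piecewise_level_of_mem _ _ _ h]; rfl
  have hleva : ∀ t ∈ B \ Iio u, S'.level t = a := fun t h => by
    rw [hS', Schedule.piecewise_level_of_notMem _ _ _ fun h' => h.2 h'.2,
      Schedule.piecewise_level_of_mem _ _ _ h.1]; rfl
  have hlev : ∀ t, t ∉ B → S'.level t = S.level t := fun t h => by
    rw [hS', Schedule.piecewise_level_of_notMem _ _ _ fun h' => h h'.1,
      Schedule.piecewise_level_of_notMem _ _ _ h]
  have hW' : M.RespectsWindows S' := fun t j' h => hS t j' (by rwa [hjob] at h)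
  have hjobset : ∀ j', {t | S'.job t = some j'} = {t | S.job t = some j'} := fun j' => by
    simp only [hjob]
  have hworkj : M.work S' j (interval τ ℓ) = M.work S j (interval τ ℓ) := by
    rw [← hu]
    unfold work
    rw [hjobset, ← hBdef, ← integral_inter_add_sdiff (measurableSet_Iio (a := u))
      (integrable_speed hW').integrableOn,
      setIntegral_congr_fun hBu (g := fun _ => M.speed b) (fun t ht => by simp only [hlevb t ht]),
      setIntegral_congr_fun (hB.diff measurableSet_Iio) (g := fun _ => M.speed a)
        (fun t ht => by simp only [hleva t ht]), setIntegral_const, setIntegral_const,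
      smul_eq_mul, smul_eq_mul,
      ← measureReal_inter_add_sdiff (s := B) (measurableSet_Iio (a := u)) hfin]
    ring
  have hwork : ∀ j', M.work S' j' (interval τ ℓ) = M.work S j' (interval τ ℓ) := by
    intro j'
    by_cases h : j' = j
    · rw [h, hworkj]
    · unfold work
      rw [hjobset]
      refine setIntegral_congr_fun (hA.inter (S.measurableSet_job j')) fun t ht => ?_
      have : t ∉ B := fun h' => h (Option.some.inj (ht.2.symm.trans h'.2))
      simp only [hlev t this]
  have hBA : interval τ ℓ ∩ B = B := inter_eq_right.2 inter_subset_left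
  have hen : ∫ t in B, M.power (S.level t) ≤ ∫ t in B, M.power (S'.level t) := by
    have h := hopt ℓ S' hW' hwork
    unfold energy at h
    rw [← integral_inter_add_sdiff hB (integrable_power hS).integrableOn,
      ← integral_inter_add_sdiff hB (integrable_power hW').integrableOn, hBA,
      setIntegral_congr_fun (hA.diff hB) (f := fun t => M.power (S'.level t))
        (g := fun t => M.power (S.level t)) (fun t ht => by simp only [hlev t ht.2])] at h
    linarith
  have hab : M.power a - y * M.speed a = M.power b - y * M.speed b := le_antisymm (ha b) (hb a)
  -- the excess of the power over the supporting line
  set g : Schedule n k → ℝ → ℝ := fun S t =>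
    M.power (S.level t) - y * M.speed (S.level t) - (M.power a - y * M.speed a) with hg
  have hconst : IntegrableOn (fun _ : ℝ => M.power a - y * M.speed a) B :=
    integrableOn_const hfin
  have hgint : ∀ S : Schedule n k, M.RespectsWindows S → IntegrableOn (g S) B := fun S hS =>
    ((integrable_power hS).integrableOn.sub ((integrable_speed hS).integrableOn.const_mul y)).sub
      hconst
  have hsplit : ∀ S : Schedule n k, M.RespectsWindows S →
      ∫ t in B, g S t = (∫ t in B, M.power (S.level t)) - y * (∫ t in B, M.speed (S.level t))
        - ∫ t in B, (M.power a - y * M.speed a) := by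
    intro S hS
    have h1 := (integrable_power hS).integrableOn (s := B)
    have h2 := ((integrable_speed hS).integrableOn (s := B)).const_mul y
    have h12 : IntegrableOn (fun t => M.power (S.level t) - y * M.speed (S.level t)) B := h1.sub h2
    simp only [hg]
    rw [integral_sub h12 hconst, integral_sub h1 h2, integral_const_mul]
  have hg' : ∫ t in B, g S' t = 0 := by
    refine setIntegral_eq_zero_of_forall_eq_zero fun t ht => ?_
    by_cases h : t < u
    · simp only [hg, hlevb t ⟨ht, h⟩]
      linarith
    · simp only [hg, hleva t ⟨ht, h⟩]
      linarith
  have hspeed : ∫ t in B, M.speed (S'.level t) = ∫ t in B, M.speed (S.level t) := by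
    have h := hworkj
    unfold work at h
    rwa [hjobset, ← hBdef] at h
  have hnonneg : ∀ t, 0 ≤ g S t := fun t => sub_nonneg.2 (ha _)
  have hzero : ∫ t in B, g S t = 0 := by
    refine le_antisymm ?_ (integral_nonneg hnonneg)
    rw [hsplit S' hW', hspeed] at hg'
    rw [hsplit S hS]
    linarith
  rw [setIntegral_eq_zero_iff_of_nonneg_ae (Filter.Eventually.of_forall hnonneg) (hgint S hS)]
    at hzero
  filter_upwards [(ae_restrict_iff' hB).1 hzero] with t ht h1 h2 i'
  have h3 : g S t = 0 := ht ⟨h1, h2⟩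
  simp only [hg] at h3
  linarith [ha i']

/-- Under the first two clauses of the speed level relation, `S` runs almost always at a speed that
supports the price of the speed level of the current job. -/
theorem ae_supports_level {a c : ℝ} (ha : 0 < a) (hc : 1 < c)
    (hgeo : ∀ i : Fin k, M.power i.succ - M.power i.castSucc
      = a * c ^ (i.val + 1) * (M.speed i.succ - M.speed i.castSucc))
    (hS : M.RespectsWindows S) (hopt : M.LocallyEnergyOptimal S τ)
    {lev : Fin n → Fin (L + 1) → ℕ}
    (hlev1 : ∀ j ℓ, M.ProcessedIn S τ j ℓ → ∀ i : Fin k,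
      M.speed i.castSucc < M.avgSpeed S τ j ℓ → M.avgSpeed S τ j ℓ < M.speed i.succ →
      lev j ℓ = i.val + 1)
    (hlev2 : ∀ j ℓ, M.ProcessedIn S τ j ℓ → ∀ i : Fin (k + 1),
      M.avgSpeed S τ j ℓ = M.speed i → lev j ℓ = i.val ∨ lev j ℓ = i.val + 1)
    (j : Fin n) (ℓ : Fin (L + 1)) :
    ∀ᵐ t, t ∈ interval τ ℓ → S.job t = some j → M.Supports (a * c ^ lev j ℓ) (S.level t) := by
  classical
  by_cases hproc : M.ProcessedIn S τ j ℓ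
  swap
  · have h0 : volume (interval τ ℓ ∩ {t | S.job t = some j}) = 0 := by
      rw [← work_eq_zero_iff hS (M := M)]
      exact le_antisymm (not_lt.1 hproc) (work_nonneg _ _ _ _)
    filter_upwards [measure_eq_zero_iff_ae_notMem.1 h0] with t ht h1 h2
    exact absurd ⟨h1, h2⟩ ht
  have hB : MeasurableSet (interval τ ℓ ∩ {t | S.job t = some j}) :=
    (measurableSet_interval τ ℓ).inter (S.measurableSet_job j)
  have hfin := volume_job_lt_top hS j (interval τ ℓ)
  set v := volume.real (interval τ ℓ ∩ {t | S.job t = some j}) with hv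
  have hv0 : 0 < v := ENNReal.toReal_pos ((work_pos_iff hS j).1 hproc).ne' hfin.ne
  have havg : M.avgSpeed S τ j ℓ * v = M.work S j (interval τ ℓ) := by
    rw [avgSpeed, ← hv, div_mul_cancel₀ _ hv0.ne']
  have hw0 : 0 < M.work S j (interval τ ℓ) := hproc
  have havg0 : 0 < M.avgSpeed S τ j ℓ := div_pos hw0 hv0
  have hlower : ∀ y, (∀ i : Fin (k + 1), i ≠ 0 → y ≤ M.speed i) → y ≤ M.avgSpeed S τ j ℓ := by
    intro y hy
    refine le_of_mul_le_mul_right ?_ hv0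
    rw [havg, hv, work, mul_comm, ← smul_eq_mul, ← setIntegral_const]
    exact setIntegral_mono_on (integrableOn_const hfin.ne) (integrable_speed hS).integrableOn hB
      fun t ht => hy _ (level_ne_zero ht.2)
  have hupper : M.avgSpeed S τ j ℓ ≤ M.speed (Fin.last k) := by
    refine le_of_mul_le_mul_right ?_ hv0
    rw [havg, hv, work, mul_comm, ← smul_eq_mul, ← setIntegral_const]
    exact setIntegral_mono_on (integrable_speed hS).integrableOn (integrableOn_const hfin.ne) hB
      fun t _ => M.speed_strictMono.monotone (Fin.le_last _)
  obtain ⟨i, hi, hmax⟩ := Finset.exists_max_image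
    (Finset.univ.filter fun i => M.speed i ≤ M.avgSpeed S τ j ℓ) id
    ⟨0, by simpa [M.speed_zero] using havg0.le⟩
  simp only [Finset.mem_filter, Finset.mem_univ, true_and, id] at hi hmax
  rcases hi.eq_or_lt with heq | hlt
  · have hi0 : i ≠ 0 := by
      rintro rfl
      rw [M.speed_zero] at heq
      exact havg0.ne heq
    have hsupp := supports_of_adjacent (M := M) ha hc hgeo (hlev2 j ℓ hproc i heq.symm)
    refine ae_supports_of_between hS hopt hi0 hi0 hsupp hsupp ?_ ?_
    · rw [heq, ← hv, havg]
    · rw [heq, ← hv, havg]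
  · obtain ⟨i, rfl⟩ : ∃ i' : Fin k, i'.castSucc = i :=
      Fin.exists_castSucc_eq.2 fun h => absurd hupper (not_le.2 (h ▸ hlt))
    have hlt' : M.avgSpeed S τ j ℓ < M.speed i.succ := by
      by_contra! hcon
      exact absurd (hmax _ hcon) (not_le.2 Fin.castSucc_lt_succ)
    -- a running processor is at least as fast as the lowest positive speed
    have hi0 : i.castSucc ≠ 0 := by
      intro h0
      refine absurd (hlower (M.speed i.succ) fun i' h' => ?_) (not_le.2 hlt')
      refine M.speed_strictMono.monotone (Fin.le_def.2 ?_)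
      have h1 : i.val = 0 := congrArg Fin.val h0
      have h2 : i'.val ≠ 0 := fun h => h' (Fin.ext h)
      simp only [Fin.val_succ]
      omega
    have hl := hlev1 j ℓ hproc i hlt hlt'
    refine ae_supports_of_between hS hopt hi0 (Fin.succ_ne_zero i)
      (supports_of_adjacent ha hc hgeo (Or.inr (by simpa using hl)))
      (supports_of_adjacent ha hc hgeo (Or.inl (by simpa using hl))) ?_ ?_
    · rw [← havg]
      exact mul_le_mul_of_nonneg_right hlt.le hv0.le
    · rw [← havg]
      exact mul_le_mul_of_nonneg_right hlt'.le hv0.le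

/-! ### A dual solution from the speed levels -/

theorem ActiveIn.of_between (hτ : StrictMono τ) (hτ0 : ∀ i, 0 < τ i) {j : Fin n}
    {ℓ₁ m ℓ₂ : Fin (L + 1)} (h₁ : M.ActiveIn τ j ℓ₁) (h₂ : M.ActiveIn τ j ℓ₂) (hm₁ : ℓ₁ ≤ m)
    (hm₂ : m ≤ ℓ₂) : M.ActiveIn τ j m := by
  rcases hm₁.eq_or_lt with rfl | hlt
  · exact h₁
  obtain ⟨t₁, ht₁, hw₁⟩ := h₁
  obtain ⟨t₂, ht₂, hw₂⟩ := h₂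
  obtain ⟨i, rfl⟩ := Fin.exists_succ_eq.2 (show m ≠ 0 from (Fin.zero_le _ |>.trans_lt hlt).ne')
  refine ⟨τ i, ⟨(hτ0 i).le, fun i' h' => hτ.monotone (Fin.le_def.2 ?_),
    fun i' h' => hτ (Fin.lt_def.2 ?_)⟩, hw₁.1.trans ?_, lt_of_le_of_lt ?_ hw₂.2⟩
  · simp only [Fin.val_succ] at h'
    omega
  · simp only [Fin.val_succ] at h'
    omega
  · exact (ht₁.2.2 i (by have := Fin.lt_def.1 hlt; simp only [Fin.val_succ] at this; omega)).le
  · exact ht₂.2.1 i (by have := Fin.le_def.1 hm₂; simp only [Fin.val_succ] at this; omega)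

/-- The differences of the speed levels between two depletion intervals, which do not depend on
the job, are the differences of a nondecreasing potential of the intervals. -/
theorem exists_potential (hτ : StrictMono τ) (hτ0 : ∀ i, 0 < τ i) {lev : Fin n → Fin (L + 1) → ℕ}
    (hlev : ∀ j j' ℓ₁ ℓ₂, ℓ₁ < ℓ₂ → M.ActiveIn τ j ℓ₁ → M.ActiveIn τ j ℓ₂ →
      M.ActiveIn τ j' ℓ₁ → M.ActiveIn τ j' ℓ₂ →
      lev j ℓ₁ ≤ lev j ℓ₂ ∧
        (lev j ℓ₂ : ℤ) - (lev j ℓ₁ : ℤ) = (lev j' ℓ₂ : ℤ) - (lev j' ℓ₁ : ℤ)) :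
    ∃ x : ℕ → ℕ, Monotone x ∧ ∀ j (ℓ₁ ℓ₂ : Fin (L + 1)), M.ActiveIn τ j ℓ₁ → M.ActiveIn τ j ℓ₂ →
      lev j ℓ₁ + x ℓ₂ = lev j ℓ₂ + x ℓ₁ := by
  classical
  have hD : ∃ D : ℕ → ℕ, ∀ (i : Fin L) j, M.ActiveIn τ j i.castSucc → M.ActiveIn τ j i.succ →
      lev j i.castSucc + D i = lev j i.succ := by
    have hi : ∀ m : ℕ, ∃ d : ℕ, ∀ i : Fin L, i.val = m → ∀ j, M.ActiveIn τ j i.castSucc →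
        M.ActiveIn τ j i.succ → lev j i.castSucc + d = lev j i.succ := by
      intro m
      by_cases h : ∃ (i : Fin L) (j : Fin n), i.val = m ∧ M.ActiveIn τ j i.castSucc ∧
          M.ActiveIn τ j i.succ
      · obtain ⟨i, j₀, rfl, h1, h2⟩ := h
        refine ⟨lev j₀ i.succ - lev j₀ i.castSucc, fun i' hi' j h3 h4 => ?_⟩
        obtain rfl := Fin.ext hi'
        have := hlev j₀ j _ _ Fin.castSucc_lt_succ h1 h2 h3 h4
        omega
      · push Not at h
        exact ⟨0, fun i hi j h1 h2 => absurd h2 (h i j hi h1)⟩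
    choose D hD using hi
    exact ⟨D, fun i j => hD i i rfl j⟩
  obtain ⟨D, hD⟩ := hD
  refine ⟨fun m => ∑ m' ∈ Finset.range m, D m', ?_, ?_⟩
  · exact fun m m' h => Finset.sum_le_sum_of_subset (Finset.range_mono h)
  have key : ∀ j (ℓ₁ : Fin (L + 1)), M.ActiveIn τ j ℓ₁ → ∀ (d : ℕ) (ℓ₂ : Fin (L + 1)),
      ℓ₂.val = ℓ₁.val + d → M.ActiveIn τ j ℓ₂ →
      lev j ℓ₁ + ∑ m ∈ Finset.range ℓ₂, D m = lev j ℓ₂ + ∑ m ∈ Finset.range ℓ₁, D m := by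
    intro j ℓ₁ h₁ d
    induction d with
    | zero => intro ℓ₂ hd _; rw [show ℓ₂ = ℓ₁ from Fin.ext hd]
    | succ d ih =>
      intro ℓ₂ hd h₂
      obtain ⟨i, rfl⟩ := Fin.exists_succ_eq.2
        (show ℓ₂ ≠ 0 by rintro rfl; simp at hd)
      simp only [Fin.val_succ] at hd
      have hact := h₁.of_between hτ hτ0 (m := i.castSucc) h₂
        (Fin.le_def.2 (by simp only [Fin.val_castSucc]; omega)) Fin.castSucc_lt_succ.le
      have h3 := ih i.castSucc (by simp only [Fin.val_castSucc]; omega) hact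
      have h4 := hD i j hact h₂
      simp only [Fin.val_castSucc] at h3
      simp only [Fin.val_succ, Finset.sum_range_succ]
      omega
  intro j ℓ₁ ℓ₂ h₁ h₂
  rcases le_total ℓ₁.val ℓ₂.val with h | h
  · exact key j ℓ₁ h₁ (ℓ₂.val - ℓ₁.val) ℓ₂ (by omega) h₂
  · exact (key j ℓ₂ h₂ (ℓ₁.val - ℓ₂.val) ℓ₁ (by omega) h₁).symm

/-! ### Weighted energy minus the value of the work -/

/-- The integrand of the Lagrangian at time `t`: the power, weighted by the multipliers `μ i` of the
battery constraints at the points `τ i` after `t`, minus the value at the prices `π j` of the work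
done before the time `σ`. -/
noncomputable def lagrangian (M : Instance n k) (S : Schedule n k) (τ : Fin L → ℝ) (μ : Fin L → ℝ)
    (π : Fin n → ℝ) (σ t : ℝ) : ℝ :=
  (∑ i, (Iio (τ i)).indicator (fun t => μ i * M.power (S.level t)) t) -
    ∑ j, (Iio σ ∩ {t | S.job t = some j}).indicator (fun t => π j * M.speed (S.level t)) t

theorem integrable_lagrangian (hS : M.RespectsWindows S) (μ : Fin L → ℝ) (π : Fin n → ℝ) (σ : ℝ) :
    Integrable (M.lagrangian S τ μ π σ) := by
  refine Integrable.sub (integrable_finsetSum _ fun i _ => ?_)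
    (integrable_finsetSum _ fun j _ => ?_)
  · exact ((integrable_power hS).const_mul _).indicator measurableSet_Iio
  · exact ((integrable_speed hS).const_mul _).indicator
      (measurableSet_Iio.inter (S.measurableSet_job j))

theorem integral_lagrangian (hS : M.RespectsWindows S) (μ : Fin L → ℝ) (π : Fin n → ℝ) (σ : ℝ) :
    ∫ t in Ici 0, M.lagrangian S τ μ π σ t
      = ∑ i, μ i * M.energy S (Ico 0 (τ i)) - ∑ j, π j * M.work S j (Ico 0 σ) := by
  have h1 : ∀ i : Fin L, Integrable
      ((Iio (τ i)).indicator fun t => μ i * M.power (S.level t)) (volume.restrict (Ici 0)) :=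
    fun i => (((integrable_power hS).const_mul _).indicator measurableSet_Iio).restrict
  have h2 : ∀ j : Fin n, Integrable ((Iio σ ∩ {t | S.job t = some j}).indicator
      fun t => π j * M.speed (S.level t)) (volume.restrict (Ici 0)) :=
    fun j => (((integrable_speed hS).const_mul _).indicator
      (measurableSet_Iio.inter (S.measurableSet_job j))).restrict
  unfold lagrangian
  rw [integral_sub (integrable_finsetSum _ fun i _ => h1 i) (integrable_finsetSum _ fun j _ => h2 j),
    integral_finsetSum _ fun i _ => h1 i, integral_finsetSum _ fun j _ => h2 j]
  congr 1
  · refine Finset.sum_congr rfl fun i _ => ?_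
    rw [setIntegral_indicator measurableSet_Iio, integral_const_mul, Ici_inter_Iio, energy]
  · refine Finset.sum_congr rfl fun j _ => ?_
    rw [setIntegral_indicator (measurableSet_Iio.inter (S.measurableSet_job j)),
      integral_const_mul, ← inter_assoc, Ici_inter_Iio, work]

theorem exists_activeIn (hτ : StrictMono τ) (j : Fin n) : ∃ ℓ, M.ActiveIn τ j ℓ := by
  obtain ⟨ℓ, hℓ⟩ := exists_mem_interval hτ (M.release_nonneg j)
  exact ⟨ℓ, M.release j, hℓ, le_rfl, M.release_lt_deadline j⟩

/-- The multipliers `Λ i' - Λ (i' + 1)` of the depletion points after a time in the interval `ℓ`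
telescope to the weight `Λ ℓ` of that interval. -/
theorem sum_multipliers {Λ : ℕ → ℝ} {i : Fin L} (hΛ : ∀ m, i.val < m → Λ m = 0)
    {ℓ : Fin (L + 1)} {t : ℝ} (ht : t ∈ interval τ ℓ) (P : ℝ → ℝ) :
    ∑ i' : Fin L, (Iio (τ i')).indicator (fun t => (Λ i' - Λ (i' + 1)) * P t) t = Λ ℓ * P t := by
  have h1 : ∀ i' : Fin L, (Iio (τ i')).indicator (fun t => (Λ i' - Λ (i' + 1)) * P t) t
      = (fun m : ℕ => if ℓ.val ≤ m then (Λ m - Λ (m + 1)) * P t else 0) i' := by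
    intro i'
    by_cases h : t < τ i'
    · have : ℓ.val ≤ i'.val := (lt_iff_le_castSucc ht i').1 h
      simp [h, this]
    · have : ¬ ℓ.val ≤ i'.val := fun h' => h ((lt_iff_le_castSucc ht i').2 h')
      simp [h, this]
  rw [Finset.sum_congr rfl fun i' _ => h1 i', Fin.sum_univ_eq_sum_range
    (fun m : ℕ => if ℓ.val ≤ m then (Λ m - Λ (m + 1)) * P t else 0), ← Finset.sum_filter]
  have h2 : (Finset.range L).filter (fun m => ℓ.val ≤ m) = Finset.Ico ℓ.val L := by
    ext m
    simp only [Finset.mem_filter, Finset.mem_range, Finset.mem_Ico]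
    omega
  have h3 := Finset.sum_Ico_sub Λ (Nat.lt_succ_iff.1 ℓ.isLt)
  rw [hΛ L i.isLt] at h3
  rw [h2, ← Finset.sum_mul]
  congr 1
  rw [← neg_inj, ← Finset.sum_neg_distrib]
  simpa using h3

/-- The schedule `S` minimizes the Lagrangian pointwise: before `σ = τ i`, the multiplier of the
current interval times the price of the speed level of a job is the constant price `π j` of the job,
so no job earns more than the one that `S` runs, and `S` runs it at an optimal speed. -/
theorem ae_lagrangian_le {a c : ℝ} (ha : 0 < a) (hc : 1 < c)
    (hgeo : ∀ i : Fin k, M.power i.succ - M.power i.castSucc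
      = a * c ^ (i.val + 1) * (M.speed i.succ - M.speed i.castSucc))
    (hτ : StrictMono τ) (hS' : M.RespectsWindows S')
    {lev : Fin n → Fin (L + 1) → ℕ}
    (hsupp : ∀ j ℓ, ∀ᵐ t, t ∈ interval τ ℓ → S.job t = some j →
      M.Supports (a * c ^ lev j ℓ) (S.level t))
    (hbusy : ∀ j j' ℓ, ∀ᵐ t, t ∈ interval τ ℓ → S.job t = some j → t ∈ M.window j' →
      lev j' ℓ ≤ lev j ℓ)
    (hidle : ∀ j ℓ, ∀ᵐ t, t ∈ interval τ ℓ → S.job t = none → t ∈ M.window j → lev j ℓ ≤ 1)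
    (hS : M.RespectsWindows S) {Λ : ℕ → ℝ} {i : Fin L} (hΛ0 : ∀ m, 0 ≤ Λ m)
    (hΛ : ∀ m, i.val < m → Λ m = 0) {π : Fin n → ℝ}
    (hπ : ∀ j (ℓ : Fin (L + 1)), ℓ ≤ i.castSucc → M.ActiveIn τ j ℓ →
      π j = Λ ℓ * (a * c ^ lev j ℓ)) :
    ∀ᵐ t, t ∈ Ici (0 : ℝ) → M.lagrangian S τ (fun i' => Λ i' - Λ (i' + 1)) π (τ i) t
      ≤ M.lagrangian S' τ (fun i' => Λ i' - Λ (i' + 1)) π (τ i) t := by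
  have hsupp' := ae_all_iff.2 fun j => ae_all_iff.2 fun ℓ => hsupp j ℓ
  have hbusy' := ae_all_iff.2 fun j => ae_all_iff.2 fun j' => ae_all_iff.2 fun ℓ => hbusy j j' ℓ
  have hidle' := ae_all_iff.2 fun j => ae_all_iff.2 fun ℓ => hidle j ℓ
  filter_upwards [hsupp', hbusy', hidle'] with t h1 h2 h3 ht
  obtain ⟨ℓ, hℓ⟩ := exists_mem_interval hτ ht
  have hnone : ∀ T : Schedule n k, T.job t = none →
      M.lagrangian T τ (fun i' => Λ i' - Λ (i' + 1)) π (τ i) t = 0 := by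
    intro T hT
    rw [lagrangian, sum_multipliers hΛ hℓ fun t => M.power (T.level t), (T.idle_iff t).1 hT,
      M.power_zero]
    simp [indicator, hT]
  have hsome : ∀ (T : Schedule n k) j, T.job t = some j →
      M.lagrangian T τ (fun i' => Λ i' - Λ (i' + 1)) π (τ i) t
        = Λ ℓ * M.power (T.level t) - if t < τ i then π j * M.speed (T.level t) else 0 := by
    intro T j hT
    rw [lagrangian, sum_multipliers hΛ hℓ fun t => M.power (T.level t)]
    congr 1
    rw [Finset.sum_eq_single j]
    · simp [indicator, hT]
    · intro j' _ hne
      simp [indicator, hT, hne.symm]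
    · simp
  by_cases hti : t < τ i
  · have hle := (lt_iff_le_castSucc hℓ i).1 hti
    -- `m` is the highest speed level of the jobs that are active at time `t`
    obtain ⟨m, hm, hmsupp, hmS⟩ : ∃ m : ℕ, (∀ j, t ∈ M.window j → lev j ℓ ≤ m) ∧
        M.Supports (a * c ^ m) (S.level t) ∧
        M.lagrangian S τ (fun i' => Λ i' - Λ (i' + 1)) π (τ i) t
          = Λ ℓ * (M.power (S.level t) - a * c ^ m * M.speed (S.level t)) := by
      rcases hjob : S.job t with _ | j
      · refine ⟨1, fun j hj => h3 j ℓ hℓ hjob hj, ?_, ?_⟩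
        · rw [(S.idle_iff t).1 hjob]
          exact supports_of_adjacent ha hc hgeo (Or.inr rfl)
        · rw [hnone S hjob, (S.idle_iff t).1 hjob, M.power_zero, M.speed_zero]
          ring
      · refine ⟨lev j ℓ, fun j' hj' => h2 j j' ℓ hℓ hjob hj', h1 j ℓ hℓ hjob, ?_⟩
        rw [hsome S j hjob, if_pos hti, hπ j ℓ hle ⟨t, hℓ, hS t j hjob⟩]
        ring
    have hcomp := mul_le_mul_of_nonneg_left (hmsupp (S'.level t)) (hΛ0 ℓ)
    rw [hmS]
    refine hcomp.trans ?_
    rcases hjob : S'.job t with _ | j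
    · rw [hnone S' hjob, (S'.idle_iff t).1 hjob, M.power_zero, M.speed_zero]
      simp
    · have hwin := hS' t j hjob
      rw [hsome S' j hjob, if_pos hti, hπ j ℓ hle ⟨t, hℓ, hwin⟩]
      have h4 : a * c ^ lev j ℓ * M.speed (S'.level t) ≤ a * c ^ m * M.speed (S'.level t) :=
        mul_le_mul_of_nonneg_right
          (mul_le_mul_of_nonneg_left (pow_le_pow_right₀ hc.le (hm j hwin)) ha.le) (speed_nonneg _)
      have h5 := mul_le_mul_of_nonneg_left h4 (hΛ0 ℓ)
      linarith
  · have hΛℓ : Λ ℓ = 0 := by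
      refine hΛ ℓ ?_
      by_contra! hcon
      exact hti ((lt_iff_le_castSucc hℓ i).2 hcon)
    have hzero : ∀ T : Schedule n k,
        M.lagrangian T τ (fun i' => Λ i' - Λ (i' + 1)) π (τ i) t = 0 := by
      intro T
      rcases hjob : T.job t with _ | j
      · exact hnone T hjob
      · rw [hsome T j hjob, if_neg hti, hΛℓ]
        ring
    rw [hzero, hzero]

/-- A feasible schedule completes the jobs with deadlines up to the split point before it, and `S`
works on no other job there. -/
theorem work_le_of_isSplitPoint (hS : M.Perfect S R τ) {i : Fin L} (hi : M.IsSplitPoint S τ i)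
    {R' : ℝ} (hS' : M.Feasible S' R') (j : Fin n) :
    M.work S j (Ico 0 (τ i)) ≤ M.work S' j (Ico 0 (τ i)) := by
  have hW := hS.feasible.2.1
  have hW' := hS'.2.1
  by_cases hj : τ i < M.deadline j
  · refine le_trans ?_ (work_nonneg _ _ _ _)
    rw [← hi j hj]
    exact work_mono hW j Ico_subset_Iio_self
  · have hall : M.work S' j (Ico 0 (τ i)) = M.work S' j univ := by
      unfold work
      congr 2
      ext t
      simp only [mem_inter_iff, mem_univ, true_and, mem_ofPred_eq, and_iff_right_iff_imp]
      exact fun ht => ⟨nonneg_of_job hW' ht, (hW' t j ht).2.trans_le (not_lt.1 hj)⟩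
    rw [hall]
    calc M.work S j (Ico 0 (τ i)) ≤ M.work S j univ := work_mono hW j (subset_univ _)
      _ = M.workload j := hS.exact_work j
      _ ≤ M.work S' j univ := hS'.2.2.1 j

/-- Before a split depletion point, the weights `c ^ (-x ℓ)` given by the potential of the speed
levels certify that the recharge rate is minimal. -/
theorem optimal_of_isSplitPoint (hsep : M.WellSeparated) (hS : M.Perfect S R τ) {i : Fin L}
    (hi : M.IsSplitPoint S τ i) : M.Optimal S R := by
  refine ⟨hS.feasible, fun S' R' hS' => ?_⟩
  have hW := hS.feasible.2.1
  have hW' := hS'.2.1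
  have hτ := hS.depletion.1
  have hτ0 := fun i => (hS.depletion.2 i).1
  obtain ⟨a, c, ha, hc, hgeo⟩ := hsep.exists_geometric
  have hc0 : 0 < c := by linarith
  obtain ⟨lev, hlev1, hlev2, hlev3, hbusy, hidle⟩ := hS.slr
  obtain ⟨x, hx, hpot⟩ := exists_potential hτ hτ0 hlev3
  set Λ : ℕ → ℝ := fun m => if m ≤ i.val then (c ^ x m)⁻¹ else 0 with hΛdef
  have hΛ0 : ∀ m, 0 ≤ Λ m := fun m => by simp only [hΛdef]; split_ifs <;> positivity
  have hΛ : ∀ m, i.val < m → Λ m = 0 := fun m hm => if_neg (not_le.2 hm)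
  have hΛanti : ∀ m, Λ (m + 1) ≤ Λ m := by
    intro m
    by_cases h : m + 1 ≤ i.val
    · simp only [hΛdef, if_pos h, if_pos ((Nat.le_succ m).trans h)]
      exact inv_anti₀ (pow_pos hc0 _) (pow_le_pow_right₀ hc.le (hx (Nat.le_succ m)))
    · rw [hΛ (m + 1) (not_le.1 h)]
      exact hΛ0 m
  choose ℓj hℓj using fun j => exists_activeIn (M := M) hτ j
  set π : Fin n → ℝ := fun j => (c ^ x (ℓj j))⁻¹ * (a * c ^ lev j (ℓj j)) with hπdef
  have hπ0 : ∀ j, 0 ≤ π j := fun j => by simp only [hπdef]; positivity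
  have hπ : ∀ j (ℓ : Fin (L + 1)), ℓ ≤ i.castSucc → M.ActiveIn τ j ℓ →
      π j = Λ ℓ * (a * c ^ lev j ℓ) := by
    intro j ℓ hℓ hact
    have h1 : ℓ.val ≤ i.val := hℓ
    have h2 := hpot j ℓ (ℓj j) hact (hℓj j)
    have h3 : c ^ lev j ℓ * c ^ x (ℓj j) = c ^ lev j (ℓj j) * c ^ x ℓ := by
      rw [← pow_add, ← pow_add, h2]
    simp only [hπdef, hΛdef, if_pos h1]
    field_simp
    linear_combination -h3
  have hae := ae_lagrangian_le ha hc hgeo hτ hW'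
    (ae_supports_level ha hc hgeo hW hS.energyOptimal hlev1 hlev2) hbusy hidle hW hΛ0 hΛ hπ
  have hint := setIntegral_mono_ae_restrict (integrable_lagrangian hW _ π (τ i)).integrableOn
    (integrable_lagrangian hW' _ π (τ i)).integrableOn ((ae_restrict_iff' measurableSet_Ici).2 hae)
  rw [integral_lagrangian hW, integral_lagrangian hW'] at hint
  have hwork : ∑ j, π j * M.work S j (Ico 0 (τ i)) ≤ ∑ j, π j * M.work S' j (Ico 0 (τ i)) :=
    Finset.sum_le_sum fun j _ =>
      mul_le_mul_of_nonneg_left (work_le_of_isSplitPoint hS hi hS' j) (hπ0 j)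
  have hen : ∑ i' : Fin L, (Λ i' - Λ (i' + 1)) * M.energy S (Ico 0 (τ i'))
      = R * ∑ i' : Fin L, (Λ i' - Λ (i' + 1)) * τ i' := by
    rw [Finset.mul_sum]
    refine Finset.sum_congr rfl fun i' _ => ?_
    have h := (hS.depletion.2 i').2
    unfold battery at h
    linear_combination -(Λ i' - Λ (i' + 1)) * h
  have hen' : ∑ i' : Fin L, (Λ i' - Λ (i' + 1)) * M.energy S' (Ico 0 (τ i'))
      ≤ R' * ∑ i' : Fin L, (Λ i' - Λ (i' + 1)) * τ i' := by
    rw [Finset.mul_sum]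
    refine Finset.sum_le_sum fun i' _ => ?_
    have h := hS'.2.2.2 (τ i') (hτ0 i').le
    unfold battery at h
    have h1 := mul_nonneg (sub_nonneg.2 (hΛanti i')) h
    linarith
  have hpos : 0 < ∑ i' : Fin L, (Λ i' - Λ (i' + 1)) * τ i' := by
    refine Finset.sum_pos' (fun i' _ => mul_nonneg (sub_nonneg.2 (hΛanti i')) (hτ0 i').le)
      ⟨i, Finset.mem_univ i, mul_pos ?_ (hτ0 i)⟩
    rw [hΛ (i + 1) (Nat.lt_succ_self _), sub_zero]
    simp only [hΛdef, le_refl, if_true]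
    positivity
  refine le_of_mul_le_mul_right ?_ hpos
  linarith

end Instance
end Solar

theorem mainTheorem4 {n k L : ℕ} (M : Solar.Instance n k) (hsep : M.WellSeparated)
    (S : Solar.Schedule n k) (R : ℝ) (τ : Fin L → ℝ) (hS : M.Perfect S R τ)
    (hmerge : ∀ i : Fin L, ¬ M.ReachesRightmost S τ i.succ → ¬ M.Mergeable S τ i)
    (ℓ₀ : Fin (L + 1)) (hcut : ¬ M.ReachesRightmost S τ ℓ₀) :
    (∃ i : Fin L, M.IsSplitPoint S τ i) ∧ M.Optimal S R := by
  obtain ⟨i, hi⟩ := Solar.Instance.exists_isSplitPoint hS hmerge hcut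
  exact ⟨⟨i, hi⟩, Solar.Instance.optimal_of_isSplitPoint hsep hS hi⟩
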